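/- Let $M>0$ and let $P$ be a probability kernel on $\mathcal X=(-\infty,M]$ such that (i) there are $\alpha,h>0$ with $P(x,A)\ge \alpha\,\ell(A)$ for all $x\in\mathcal X$ and $A\in\mathcal B(\mathcal X)$, where $\ell(A)=\frac1{2h}\mathrm{Leb}([-h,h]\cap A)$; (ii) $\int_{\mathcal X}|x|\,P(z,dx)<\infty$ and $\int_{\mathcal X}x\,P(z,dx)=0$ for every $z\in\mathcal X$. Fix thresholds $\underline\theta<0<\overline\theta$ and put $$\mathcal U=(-\infty,0)\times(-\infty,\underline\theta)\times(0,M]\times(\overline\theta,\overline\theta+M)\times(\mathbb N\setminus\{0\}).$$ Then there exist a probability measure $\upsilon$ on $\mathcal B(\mathcal U)$ (regarded also as a measure on $\mathbb R^4\times\mathbb N$ concentrated on $\mathcal U$) and constants $C<\infty$, $\rho\in(0,1)$, depending only on $M,P,\underline\theta,\overline\theta$, such that the following holds for every time-homogeneous Markov chain $(X_n)_{n\ge0}$ in $\mathcal X$ with transition kernel $P$, defined on a probability space $(\Omega,\mathcal F,\mathbb P)$ and satisfying $\mathbb E X_n^2<\infty$ for all $n\ge1$, and for every real random variable $S_0$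 independent of $\sigma(X_k:k\ge 0)$. Let $S_n=S_0+X_1+\dots+X_n$, $L_0=0$ and, for $n\ge0$, $$T_{n+1}=\min\{k>L_n: S_k<\underline\theta\},\qquad L_{n+1}=\min\{k>T_{n+1}: S_k>\overline\theta\}.$$ Then almost surely all $T_n,L_n$, $n\ge1$, are finite, so that $U_n=(X_{T_n},S_{T_n},X_{L_n},S_{L_n},L_n-T_n)$, $n\ge1$, are almost surely well-defined random elements of $\mathbb R^4\times\mathbb N$; moreover $$\sup_{A\in\mathcal B(\mathbb R^4\times\mathbb N)}|\mathbb P(U_n\in A)-\upsilon(A)|\le C\rho^n\qquad\text{for all } n\ge1,$$ and for every bounded measurable $\phi:\mathbb R^4\times\mathbb N\to\mathbb R$, $$\frac1n\sum_{j=1}^n\phi(U_j)\to\int\phi\,d\upsilon\qquad\text{almost surely as } n\to\infty.$$ -/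

import Mathlib

open MeasureTheory ProbabilityTheory Filter Topology

universe u

namespace LevelCrossing

noncomputable section

/-- `X` is a time-homogeneous Markov chain under `μ` with transition kernel `κ`: for all `n` and
all measurable `A`, almost surely `μ(X (n+1) ∈ A ∣ σ(X 0, …, X n)) = κ(X n, A)`. -/
def IsMarkovChain {Ω E : Type*} [MeasurableSpace Ω] [MeasurableSpace E]
    (κ : Kernel E E) (X : ℕ → Ω → E) (μ : Measure Ω) : Prop :=
  (∀ n, Measurable (X n)) ∧
    ∀ (n : ℕ) (A : Set E), MeasurableSet A →
      μ[(X (n + 1) ⁻¹' A).indicator (fun _ => (1 : ℝ)) |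
          ⨆ i ≤ n, MeasurableSpace.comap (X i) inferInstance]
        =ᵐ[μ] fun ω => (κ (X n ω)).real A

/-- The normalized Lebesgue measure on `[-h, h]`, evaluated at a set `A` of points of `(-∞, M]`. -/
def normLeb {M : ℝ} (h : ℝ) (A : Set (Set.Iic M)) : ENNReal :=
  ENNReal.ofReal (1 / (2 * h)) * volume (Set.Icc (-h) h ∩ Subtype.val '' A)

/-- The minorization condition: `P(x, A) ≥ α ℓ(A)` for some `α, h > 0` and all `x` and `A`, with
`ℓ` the normalized Lebesgue measure on `[-h, h]`. -/
def Minorized {M : ℝ} (P : Kernel (Set.Iic M) (Set.Iic M)) : Prop :=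
  ∃ α h : ℝ, 0 < α ∧ 0 < h ∧
    ∀ (x : Set.Iic M) (A : Set (Set.Iic M)), MeasurableSet A →
      ENNReal.ofReal α * normLeb h A ≤ P x A

/-- From every state, the next state is integrable with mean zero. -/
def ZeroMean {M : ℝ} (P : Kernel (Set.Iic M) (Set.Iic M)) : Prop :=
  ∀ z : Set.Iic M, Integrable (fun y : Set.Iic M => (y : ℝ)) (P z) ∧
    ∫ y : Set.Iic M, (y : ℝ) ∂(P z) = 0

/-- The walk `s₀ + x 1 + ⋯ + x n`. -/
def walk (s₀ : ℝ) (x : ℕ → ℝ) (n : ℕ) : ℝ :=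
  s₀ + ∑ k ∈ Finset.Icc 1 n, x k

/-- `min {k > m : s k ∈ B}`, with value `⊤` if there is no such `k`. -/
def firstAfter (s : ℕ → ℝ) (B : Set ℝ) (m : ℕ∞) : ℕ∞ :=
  sInf ((fun k : ℕ => (k : ℕ∞)) '' {k : ℕ | m < (k : ℕ∞) ∧ s k ∈ B})

/-- The times `L n`: `L 0 = 0`, and `L (n+1)` is the first time above `b` after the first time
below `a` after `L n`. -/
def timeL (a b : ℝ) (s : ℕ → ℝ) : ℕ → ℕ∞
  | 0 => 0
  | n + 1 => firstAfter s (Set.Ioi b) (firstAfter s (Set.Iio a) (timeL a b s n))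

/-- The times `T n`, `n ≥ 1`: `T (n+1)` is the first time below `a` after `L n`. (The value at
`0` is a placeholder which is never used.) -/
def timeT (a b : ℝ) (s : ℕ → ℝ) : ℕ → ℕ∞
  | 0 => 0
  | n + 1 => firstAfter s (Set.Iio a) (timeL a b s n)

/-- The crossing data `U n = (x_{T n}, s_{T n}, x_{L n}, s_{L n}, L n - T n)`, `n ≥ 1`, of the walk
with start `s₀` and increments `x`. It is meaningful when `T n` and `L n` are finite. -/
def crossing (a b s₀ : ℝ) (x : ℕ → ℝ) (n : ℕ) : ℝ × ℝ × ℝ × ℝ × ℕ :=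
  let s := walk s₀ x
  let t := (timeT a b s n).toNat
  let l := (timeL a b s n).toNat
  (x t, s t, x l, s l, l - t)

/-- The set `(-∞,0) × (-∞,a) × (0,M] × (b,b+M) × (ℕ ∖ {0})`. -/
def stateSpace (M a b : ℝ) : Set (ℝ × ℝ × ℝ × ℝ × ℕ) :=
  Set.Iio 0 ×ˢ Set.Iio a ×ˢ Set.Ioc 0 M ×ˢ Set.Ioo b (b + M) ×ˢ {m : ℕ | m ≠ 0}

/-- Total variation distance of two probability measures, `sup_A |μ(A) - ν(A)|` over measurable
sets `A`. -/
def tvDist {E : Type*} [MeasurableSpace E] (μ ν : Measure E) : ℝ :=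
  ⨆ A : {A : Set E // MeasurableSet A}, |μ.real A.1 - ν.real A.1|

end

end LevelCrossing

/-! Write a, b for the two thresholds. The pair (state of the chain, position of the walk) observed
at the upcrossing times L_n is itself a Markov chain. The crossing data after L_n depend on the past
only through that pair, which is read off from U_n by `restart`. This is the strong Markov property
at L_1, `renews_crossingKernel`. The theorem then reduces to a Doeblin condition for the embedded
chain.

After an upcrossing the walk lies in (b, b + M], because the last jump starts at or below b and is
at most M. From such a state boundedly many small steps, each with a density bounded below on [-h,
h], take the walk below a, then close to b, then over b. The last two of them produce a component `ε
• landingLaw` of the next upcrossing state that does not depend on the starting state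
(`SmallSteps.exists_minorization`). Doeblin's argument yields an invariant law π and a geometric
contraction, and the contraction makes correlations summable, so that a second moment estimate gives
the law of large numbers (`Renews.exists_stationary`). The limit υ is the law of U_1 when the
embedded chain starts from π.

The crossing times are finite because the walk is unbounded in both directions
(`ae_not_mem_boundedPaths`). Bounded harmonic functions being constant, the event I of staying
bounded below has a probability not depending on the start. Under the stationary path law the depth
D of the minimum satisfies the Lindley recursion D = max(0, D∘θ - f∘θ). Integrating it over I, where
f has mean zero, shows that the truncation at 0 is almost surely inactive on I, so each shift adds
an increment to D. Steps of size at least δ, always possible, would then force D to exceed every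
multiple of δ, so I is null.

The law υ lives on the open set `stateSpace`: the value b + M is reached only by a jump from exactly
b. The states from which the level b can be hit (`levelStates`) are null for `landingLaw`, and the
embedded chain cannot enter them from outside, so π ignores them. -/

namespace LevelCrossing

open scoped ENNReal

/-! ### Path laws of a Markov chain and the Markov property at fixed times -/

section PathSpace

variable {E : Type*} [MeasurableSpace E]

/-- The path `x` frozen at time `n`. -/
def stopPath (n : ℕ) (x : ℕ → E) : ℕ → E := fun i => x (min i n)

/-- The path `x` seen from time `n`. -/
def shiftPath (n : ℕ) (x : ℕ → E) : ℕ → E := fun k => x (n + k)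

@[fun_prop]
lemma measurable_stopPath (n : ℕ) : Measurable (stopPath n : (ℕ → E) → ℕ → E) :=
  measurable_pi_iff.2 fun i => measurable_pi_apply (min i n)

@[fun_prop]
lemma measurable_shiftPath (n : ℕ) : Measurable (shiftPath n : (ℕ → E) → ℕ → E) :=
  measurable_pi_iff.2 fun i => measurable_pi_apply (n + i)

/-- The law of a path on which each next state has conditional law `P` given the past. -/
def MarkovLaw (P : Kernel E E) (m : Measure (ℕ → E)) : Prop :=
  ∀ (n : ℕ) (S : Set (ℕ → E)) (A : Set E), MeasurableSet S → MeasurableSet A →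
    m (stopPath n ⁻¹' S ∩ {x | x (n + 1) ∈ A}) = ∫⁻ x in stopPath n ⁻¹' S, P (x n) A ∂m

/-- The transition kernel as a function of the whole past. -/
noncomputable def historyKernel (P : Kernel E E) (n : ℕ) :
    Kernel ((i : Finset.Iic n) → (fun _ : ℕ => E) i) ((fun _ : ℕ => E) (n + 1)) :=
  P.comap (fun x => x ⟨n, Finset.mem_Iic.2 le_rfl⟩) (measurable_pi_apply _)

instance (P : Kernel E E) [IsMarkovKernel P] (n : ℕ) : IsMarkovKernel (historyKernel P n) := by
  unfold historyKernel; infer_instance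

/-- The law of the Markov chain with transition kernel `P` as a function of the initial state. -/
noncomputable def pathKernel (P : Kernel E E) [IsMarkovKernel P] : Kernel E (ℕ → E) :=
  (Kernel.traj (X := fun _ => E) (historyKernel P) 0).comap (fun x _ => x)
    (measurable_pi_iff.2 fun _ => measurable_id)

variable (P : Kernel E E) [IsMarkovKernel P]

instance : IsMarkovKernel (pathKernel P) := by unfold pathKernel; infer_instance

lemma pathKernel_map_zero (x : E) :
    (pathKernel P x).map (fun y => y 0) = Measure.dirac x := by
  have h := Kernel.traj_map_frestrictLe_apply (X := fun _ => E) (κ := historyKernel P) 0 0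
    (fun _ => x)
  rw [Kernel.partialTraj_self, Kernel.id_apply] at h
  have h2 := congrArg (Measure.map (fun y => y ⟨0, by simp⟩)) h
  rw [Measure.map_map (by fun_prop) (by fun_prop), Measure.map_dirac' (by fun_prop)] at h2
  exact h2

lemma markovLaw_pathKernel (x : E) : MarkovLaw P (pathKernel P x) := by
  intro n S A hS hA
  have h := Kernel.partialTraj_compProd_eq_map_traj (X := fun _ => E) (κ := historyKernel P)
    (a := 0) (b := n) (Nat.zero_le n) (x₀ := fun _ => x)
  -- `q` extends a history up to time n by its last value, so `stopPath n` is `q` applied to the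
  -- restriction of the path.
  let q : ((i : Finset.Iic n) → E) → ℕ → E := fun y i => y ⟨min i n, by simp⟩
  have hq : Measurable q := measurable_pi_iff.2 fun i => measurable_pi_apply _
  have h2 := congrArg (fun m => m ((q ⁻¹' S) ×ˢ A)) h
  rw [Measure.compProd_apply_prod (hq hS) hA,
    Measure.map_apply (by fun_prop) ((hq hS).prod hA),
    ← Kernel.traj_map_frestrictLe_apply, setLIntegral_map (hq hS)
      (Kernel.measurable_coe _ hA) (by fun_prop)] at h2
  exact h2.symm

lemma MarkovLaw.restrict_map {P : Kernel E E} {m : Measure (ℕ → E)}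
    (h : MarkovLaw P m) (n : ℕ) {S : Set (ℕ → E)} (hS : MeasurableSet S) :
    (m.restrict (stopPath n ⁻¹' S)).map (fun x => x (n + 1)) =
      ((m.restrict (stopPath n ⁻¹' S)).map (fun x => x n)).bind P := by
  ext A hA
  rw [Measure.map_apply (by fun_prop) hA, Measure.bind_apply hA (by fun_prop),
    lintegral_map (Kernel.measurable_coe _ hA) (by fun_prop),
    Measure.restrict_apply (measurable_pi_apply _ hA), Set.inter_comm]
  exact h n S A hS hA

lemma MarkovLaw.lintegral_succ {P : Kernel E E} {m : Measure (ℕ → E)}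
    (h : MarkovLaw P m) (n : ℕ) {S : Set (ℕ → E)} (hS : MeasurableSet S)
    {g : E → ℝ≥0∞} (hg : Measurable g) :
    ∫⁻ x in stopPath n ⁻¹' S, g (x (n + 1)) ∂m =
      ∫⁻ x in stopPath n ⁻¹' S, ∫⁻ y, g y ∂(P (x n)) ∂m := by
  have := congrArg (fun ν => ∫⁻ y, g y ∂ν) (h.restrict_map n hS)
  rwa [lintegral_map hg (by fun_prop), Measure.lintegral_bind (by fun_prop) (by fun_prop),
    lintegral_map (by fun_prop) (by fun_prop)] at this

/-- The probability, from a given state, that the first `k` states lie in the sets `A i`. -/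
noncomputable def cylProb (P : Kernel E E) : ℕ → (ℕ → Set E) → E → ℝ≥0∞
  | 0, _ => fun _ => 1
  | k + 1, A => (A 0).indicator fun x => ∫⁻ y, cylProb P k (fun i => A (i + 1)) y ∂(P x)

omit [IsMarkovKernel P] in
lemma measurable_cylProb (k : ℕ) (A : ℕ → Set E) (hA : ∀ i, MeasurableSet (A i)) :
    Measurable (cylProb P k A) := by
  induction k generalizing A with
  | zero => exact measurable_const
  | succ k ih =>
    exact ((ih _ fun i => hA _).lintegral_kernel).indicator (hA 0)

/-- Induction on the number of constraints: the constraint at time n is absorbed into the past, and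
integrating out the next state unfolds `cylProb` once. -/
lemma MarkovLaw.measure_cyl {P : Kernel E E} {m : Measure (ℕ → E)}
    (h : MarkovLaw P m) (k : ℕ) (A : ℕ → Set E) (hA : ∀ i, MeasurableSet (A i)) (n : ℕ)
    {S : Set (ℕ → E)} (hS : MeasurableSet S) :
    m (stopPath n ⁻¹' S ∩ {x | ∀ i < k, x (n + i) ∈ A i}) =
      ∫⁻ x in stopPath n ⁻¹' S, cylProb P k A (x n) ∂m := by
  induction k generalizing A n S with
  | zero => simp [cylProb]
  | succ k ih =>
    have hS' : MeasurableSet (stopPath n ⁻¹' S ∩ {x : ℕ → E | x n ∈ A 0}) :=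
      (measurable_stopPath n hS).inter (measurable_pi_apply n (hA 0))
    have hS0 : MeasurableSet (S ∩ {x : ℕ → E | x n ∈ A 0}) :=
      hS.inter (measurable_pi_apply n (hA 0))
    have hA0 : MeasurableSet {x : ℕ → E | x n ∈ A 0} := measurable_pi_apply n (hA 0)
    -- The same event is read as past of time n + 1, for the induction hypothesis, and in `e1'` as
    -- past of time n, for integrating the next state.
    have e1 : stopPath n ⁻¹' S ∩ {x | x n ∈ A 0} =
        stopPath (n + 1) ⁻¹' (stopPath n ⁻¹' S ∩ {x : ℕ → E | x n ∈ A 0}) := by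
      ext x
      have : stopPath n (stopPath (n + 1) x) = stopPath n x := by
        ext i; simp only [stopPath]; congr 1; omega
      simp only [Set.mem_inter_iff, Set.mem_preimage, this, Set.mem_ofPred_eq]
      simp [stopPath]
    have e1' : stopPath n ⁻¹' S ∩ {x | x n ∈ A 0} =
        stopPath n ⁻¹' (S ∩ {x : ℕ → E | x n ∈ A 0}) := by
      ext x; simp [stopPath]
    have e2 : stopPath n ⁻¹' S ∩ {x | ∀ i < k + 1, x (n + i) ∈ A i} =
        stopPath (n + 1) ⁻¹' (stopPath n ⁻¹' S ∩ {x : ℕ → E | x n ∈ A 0}) ∩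
          {x | ∀ i < k, x (n + 1 + i) ∈ A (i + 1)} := by
      rw [← e1, Set.inter_assoc]
      congr 1
      ext x
      simp only [Set.mem_ofPred_eq, Set.mem_inter_iff]
      constructor
      · intro hx
        exact ⟨hx 0 (by omega), fun i hi => by
          have := hx (i + 1) (by omega); rwa [show n + 1 + i = n + (i + 1) by omega]⟩
      · rintro ⟨h0, hx⟩ i hi
        cases i with
        | zero => exact h0
        | succ i =>
          have := hx i (by omega); rwa [show n + 1 + i = n + (i + 1) by omega] at this
    rw [e2, ih _ (fun i => hA _) (n + 1) hS', ← e1, e1',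
      h.lintegral_succ n hS0
        (measurable_cylProb P k _ fun i => hA _), ← e1',
      Set.inter_comm, ← Measure.restrict_restrict hA0, ← lintegral_indicator hA0]
    rfl

omit [IsMarkovKernel P] in
lemma measure_ext_cyl {m₁ m₂ : Measure (ℕ → E)} [IsFiniteMeasure m₁]
    (h : ∀ (k : ℕ) (A : ℕ → Set E), (∀ i, MeasurableSet (A i)) →
      m₁ {x | ∀ i < k, x i ∈ A i} = m₂ {x | ∀ i < k, x i ∈ A i}) : m₁ = m₂ := by
  refine ext_of_generate_finite _ (generateFrom_squareCylinders (α := fun _ : ℕ => E)).symm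
    (isPiSystem_squareCylinders (fun _ ↦ MeasurableSpace.isPiSystem_measurableSet) (by simp))
    ?_ (by simpa using h 0 (fun _ => Set.univ))
  rintro _ ⟨s, t, ht, rfl⟩
  classical
  have := h (s.sup id + 1) (fun i => if i ∈ s then t i else Set.univ) (fun i => by
    split_ifs
    · exact ht i trivial
    · exact MeasurableSet.univ)
  have e : (s : Set ℕ).pi t =
      {x : ℕ → E | ∀ i < s.sup id + 1, x i ∈ if i ∈ s then t i else Set.univ} := by
    ext x
    simp only [Set.mem_pi, Finset.mem_coe, Set.mem_ofPred_eq]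
    constructor
    · intro hx i _
      split_ifs with his
      · exact hx i his
      · trivial
    · intro hx i hi
      have := hx i (Nat.lt_succ_of_le (Finset.le_sup (f := id) hi))
      rwa [if_pos hi] at this
  rw [e, this]

/-- The Markov property at a fixed time. -/
theorem MarkovLaw.restrict_map_shift {m : Measure (ℕ → E)} [IsFiniteMeasure m]
    (h : MarkovLaw P m) (n : ℕ) {S : Set (ℕ → E)} (hS : MeasurableSet S) :
    (m.restrict (stopPath n ⁻¹' S)).map (shiftPath n) =
      ((m.restrict (stopPath n ⁻¹' S)).map (fun x => x n)).bind (pathKernel P) := by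
  refine measure_ext_cyl fun k A hA => ?_
  have hm : MeasurableSet {x : ℕ → E | ∀ i < k, x i ∈ A i} := by
    simp only [Set.ofPred_forall]
    exact MeasurableSet.iInter fun i => MeasurableSet.iInter fun _ => measurable_pi_apply i (hA i)
  -- Applying `measure_cyl` to the path kernel itself identifies its cylinder probabilities, so both
  -- sides are governed by the same `cylProb`.
  have key : ∀ x, pathKernel P x {x | ∀ i < k, x i ∈ A i} = cylProb P k A x := fun x => by
    have h1 := (markovLaw_pathKernel P x).measure_cyl k A hA 0 MeasurableSet.univ
    simp only [Set.preimage_univ, Set.univ_inter, Measure.restrict_univ, zero_add] at h1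
    rw [h1, ← lintegral_map (measurable_cylProb P k A hA) (by fun_prop),
      pathKernel_map_zero, lintegral_dirac' _ (measurable_cylProb P k A hA)]
  rw [Measure.map_apply (by fun_prop) hm, Measure.bind_apply hm (by fun_prop),
    lintegral_map (Kernel.measurable_coe _ hm) (by fun_prop),
    Measure.restrict_apply (measurable_shiftPath n hm), Set.inter_comm]
  simp only [key]
  exact h.measure_cyl k A hA n hS

/-- The Markov property at a fixed time, jointly with the past. -/
theorem MarkovLaw.map_stop_shift {m : Measure (ℕ → E)} [IsFiniteMeasure m]
    (h : MarkovLaw P m) (n : ℕ) :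
    m.map (fun x => (stopPath n x, shiftPath n x)) =
      (m.map (stopPath n)) ⊗ₘ ((pathKernel P).comap (fun x : ℕ → E => x n)
        (measurable_pi_apply n)) := by
  refine Measure.ext_prod fun {S T} hS hT => ?_
  rw [Measure.map_apply (by fun_prop) (hS.prod hT), Measure.compProd_apply_prod hS hT,
    setLIntegral_map hS (Kernel.measurable_coe _ hT) (by fun_prop)]
  have := congrArg (fun ν => ν T) (h.restrict_map_shift P n hS)
  rw [Measure.map_apply (by fun_prop) hT, Measure.bind_apply hT (by fun_prop),
    lintegral_map (Kernel.measurable_coe _ hT) (by fun_prop),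
    Measure.restrict_apply (measurable_shiftPath n hT), Set.inter_comm] at this
  refine this.trans ?_
  simp [stopPath, Kernel.comap_apply]

/-- This form serves random times: on the event that a stopping time equals n, past and future enter
through the two arguments of G. -/
lemma lintegral_stop_shift (x : E) (n : ℕ) {G : (ℕ → E) → (ℕ → E) → ℝ≥0∞}
    (hG : Measurable (Function.uncurry G)) :
    ∫⁻ y, G (stopPath n y) (shiftPath n y) ∂(pathKernel P x) =
      ∫⁻ y, ∫⁻ z, G (stopPath n y) z ∂(pathKernel P (y n)) ∂(pathKernel P x) := by
  have := congrArg (fun ν => ∫⁻ p, Function.uncurry G p ∂ν)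
    ((markovLaw_pathKernel P x).map_stop_shift P n)
  rw [lintegral_map hG (by fun_prop), Measure.lintegral_compProd hG,
    lintegral_map (Measurable.lintegral_kernel_prod_right (f := fun a b =>
      Function.uncurry G (a, b)) hG) (by fun_prop)] at this
  simpa [Kernel.comap_apply, stopPath] using this

lemma MarkovLaw.eq_bind {m : Measure (ℕ → E)} [IsFiniteMeasure m] (h : MarkovLaw P m) :
    m = (m.map (fun x => x 0)).bind (pathKernel P) := by
  have := h.restrict_map_shift P 0 MeasurableSet.univ
  simp only [Set.preimage_univ, Measure.restrict_univ] at this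
  rw [← this]
  have e : (shiftPath 0 : (ℕ → E) → ℕ → E) = id := by ext; simp [shiftPath]
  rw [e, Measure.map_id]

/-- The first step: the path seen from time `1`, jointly with the state at time `1`. -/
lemma pathKernel_map_shift_one (x : E) :
    (pathKernel P x).map (shiftPath 1) = (P x).bind (pathKernel P) := by
  have h0 := (markovLaw_pathKernel P x).restrict_map 0 MeasurableSet.univ
  have h1 := (markovLaw_pathKernel P x).restrict_map_shift P 1 MeasurableSet.univ
  simp only [Set.preimage_univ, Measure.restrict_univ, zero_add] at h0 h1
  rw [h1, h0, pathKernel_map_zero, Measure.dirac_bind (by fun_prop)]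

lemma ae_pathKernel_zero [MeasurableSingletonClass E] (x : E) :
    ∀ᵐ y ∂(pathKernel P x), y 0 = x := by
  have : ∀ᵐ z ∂((pathKernel P x).map (fun y => y 0)), z = x := by
    rw [pathKernel_map_zero]; simp
  exact ae_of_ae_map (measurable_pi_apply 0).aemeasurable this

lemma IsMarkovChain.markovLaw {Ω : Type*} [mΩ : MeasurableSpace Ω] {μ : Measure Ω}
    [IsProbabilityMeasure μ] {X : ℕ → Ω → E} (h : IsMarkovChain P X μ) :
    MarkovLaw P (μ.map fun ω n => X n ω) := by
  have hX : Measurable fun ω n => X n ω := measurable_pi_iff.2 h.1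
  intro n S A hS hA
  have h1 : ∫ ω in (fun ω => stopPath n fun k => X k ω) ⁻¹' S,
      (X (n + 1) ⁻¹' A).indicator (fun _ => (1 : ℝ)) ω ∂μ =
      ∫ ω in (fun ω => stopPath n fun k => X k ω) ⁻¹' S, (P (X n ω)).real A ∂μ := by
    let 𝓕 : MeasurableSpace Ω := ⨆ i ≤ n, MeasurableSpace.comap (X i) inferInstance
    have hle : 𝓕 ≤ mΩ :=
      iSup₂_le fun i _ => (h.1 i).comap_le
    have hst : Measurable[𝓕] fun ω => stopPath n fun k => X k ω := by
      refine @measurable_pi_iff _ _ _ 𝓕 _ _ |>.2 fun i => ?_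
      have : MeasurableSpace.comap (X (min i n)) inferInstance ≤ 𝓕 :=
        le_iSup₂_of_le (min i n) (min_le_right _ _) le_rfl
      exact (comap_measurable (X (min i n))).mono this le_rfl
    have hF : MeasurableSet[𝓕] ((fun ω => stopPath n fun k => X k ω) ⁻¹' S) := hst hS
    have hc := h.2 n A hA
    have hi : Integrable ((X (n + 1) ⁻¹' A).indicator fun _ => (1 : ℝ)) μ :=
      (integrable_const 1).indicator (h.1 _ hA)
    refine (setIntegral_condExp hle hi hF).symm.trans ?_
    exact setIntegral_congr_ae (hle _ hF) (hc.mono fun ω hω _ => hω)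
  have hA1 : MeasurableSet {x : ℕ → E | x (n + 1) ∈ A} := measurable_pi_apply _ hA
  rw [Measure.map_apply hX ((measurable_stopPath n hS).inter hA1),
    setLIntegral_map (f := fun x : ℕ → E => P (x n) A) (measurable_stopPath n hS)
      ((Kernel.measurable_coe _ hA).comp (measurable_pi_apply n)) hX]
  rw [integral_indicator (h.1 _ hA), Measure.restrict_restrict (h.1 _ hA)] at h1
  simp only [integral_const, smul_eq_mul, mul_one] at h1
  have h2 : ∫⁻ ω in (fun ω => stopPath n fun k => X k ω) ⁻¹' S, P (X n ω) A ∂μ =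
      ENNReal.ofReal (∫ ω in (fun ω => stopPath n fun k => X k ω) ⁻¹' S,
        (P (X n ω)).real A ∂μ) := by
    rw [ofReal_integral_eq_lintegral_ofReal]
    · simp
    · refine (Integrable.of_bound (C := 1) ?_ ?_)
      · exact (((Kernel.measurable_coe P hA).comp (h.1 n)).ennreal_toReal).aestronglyMeasurable
      · exact Eventually.of_forall fun ω => by
          rw [Real.norm_of_nonneg measureReal_nonneg]; exact measureReal_le_one
    · exact Eventually.of_forall fun ω => measureReal_nonneg
  refine Eq.trans ?_ h2.symm
  rw [← h1]
  simp only [measureReal_restrict_apply MeasurableSet.univ, Set.univ_inter, measureReal_def, ]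
  rw [ENNReal.ofReal_toReal (measure_ne_top _ _), Set.inter_comm]
  rfl

end PathSpace

/-! ### Doeblin contraction and the invariant law -/

section Doeblin

variable {E : Type*} [MeasurableSpace E]

lemma integral_mem_Icc_of_forall_mem {ν : Measure E} [IsFiniteMeasure ν] {E' : Set E}
    (hν : ν E'ᶜ = 0) {f : E → ℝ} (hf : Measurable f) {m r : ℝ}
    (h : ∀ x ∈ E', m ≤ f x ∧ f x ≤ m + r) :
    m * ν.real Set.univ ≤ ∫ x, f x ∂ν ∧ ∫ x, f x ∂ν ≤ (m + r) * ν.real Set.univ := by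
  have hae : ∀ᵐ x ∂ν, x ∈ E' := by rw [ae_iff]; exact hν
  have hi : Integrable f ν := by
    refine Integrable.of_bound (C := |m| + |m + r|) hf.aestronglyMeasurable ?_
    filter_upwards [hae] with x hx
    have := h x hx
    rw [Real.norm_eq_abs]
    rcases abs_cases (f x) with h1 | h1 <;> rcases abs_cases m with h2 | h2 <;>
      rcases abs_cases (m + r) with h3 | h3 <;> linarith
  constructor
  · have := integral_mono_ae (integrable_const m) hi (hae.mono fun x hx => (h x hx).1)
    simpa [mul_comm] using this
  · have := integral_mono_ae hi (integrable_const (m + r)) (hae.mono fun x hx => (h x hx).2)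
    simpa [mul_comm] using this

variable (Q : Kernel E E) [IsMarkovKernel Q] {E' : Set E} {β : Measure E} [IsFiniteMeasure β]

/-- The common part β contributes the same amount for every x. What remains has mass 1 - β(univ) and
lives on E', so the oscillation of f shrinks by that factor. -/
lemma doeblin_integral {D : Type*} [MeasurableSpace D] (R : Kernel D E) [IsMarkovKernel R]
    {D' : Set D} (hR : ∀ x, R x E'ᶜ = 0) (hβ : ∀ x ∈ D', β ≤ R x)
    {f : E → ℝ} (hf : Measurable f) {m r : ℝ} (h : ∀ x ∈ E', m ≤ f x ∧ f x ≤ m + r) :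
    ∃ m', ∀ x ∈ D', m' ≤ ∫ y, f y ∂(R x) ∧
      ∫ y, f y ∂(R x) ≤ m' + (1 - β.real Set.univ) * r := by
  refine ⟨m * (1 - β.real Set.univ) + ∫ y, f y ∂β, fun x hx => ?_⟩
  have hadd : R x - β + β = R x := Measure.sub_add_cancel_of_le (hβ x hx)
  have hsub : (R x - β) E'ᶜ = 0 := le_antisymm ((Measure.sub_le _).trans (hR x).le) bot_le
  have hmass : (R x - β).real Set.univ = 1 - β.real Set.univ := by
    have h1 : (R x - β + β).real Set.univ = 1 := by rw [hadd]; simp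
    rw [measureReal_add_apply] at h1
    linarith
  have hβ0 : β E'ᶜ = 0 := le_antisymm ((hβ x hx _).trans (hR x).le) bot_le
  have hint : ∀ ν : Measure E, IsFiniteMeasure ν → ν E'ᶜ = 0 → Integrable f ν := by
    intro ν _ hν
    have hae : ∀ᵐ x ∂ν, x ∈ E' := by rw [ae_iff]; exact hν
    refine Integrable.of_bound (C := |m| + |m + r|) hf.aestronglyMeasurable ?_
    filter_upwards [hae] with x hx
    have := h x hx
    rw [Real.norm_eq_abs]
    rcases abs_cases (f x) with h1 | h1 <;> rcases abs_cases m with h2 | h2 <;>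
      rcases abs_cases (m + r) with h3 | h3 <;> linarith
  have hI : ∫ y, f y ∂(R x) = ∫ y, f y ∂(R x - β) + ∫ y, f y ∂β := by
    rw [← integral_add_measure (hint _ inferInstance hsub) (hint _ inferInstance hβ0), hadd]
  have := integral_mem_Icc_of_forall_mem hsub hf h
  rw [hmass] at this
  rw [hI]
  constructor
  · linarith [this.1]
  · linarith [this.2]

/-- The part of the law of a Doeblin chain at time `n` that has not regenerated since time `0`. -/
noncomputable def residualLaw (β : Measure E) : ℕ → Measure E
  | 0 => β
  | n + 1 => (residualLaw β n).bind Q - residualLaw β n Set.univ • β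

variable (hQ : ∀ x, Q x E'ᶜ = 0) (hβ : ∀ x ∈ E', β ≤ Q x) (hβE : β E'ᶜ = 0)

omit [IsMarkovKernel Q] [IsFiniteMeasure β] in
include hQ hβE in
lemma residualLaw_compl (n : ℕ) (hE' : MeasurableSet E') : residualLaw Q β n E'ᶜ = 0 := by
  cases n with
  | zero => exact hβE
  | succ n =>
    refine le_antisymm ((Measure.sub_le _).trans ?_) bot_le
    rw [Measure.bind_apply hE'.compl (by fun_prop)]
    simp [hQ]

instance isFiniteMeasure_residualLaw (n : ℕ) : IsFiniteMeasure (residualLaw Q β n) := by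
  induction n with
  | zero => assumption
  | succ n ih =>
    have : IsFiniteMeasure ((residualLaw Q β n).bind Q) := by infer_instance
    unfold residualLaw
    infer_instance

omit [IsMarkovKernel Q] [IsFiniteMeasure β] in
include hQ hβ hβE in
lemma residualLaw_smul_le (n : ℕ) (hE' : MeasurableSet E') :
    residualLaw Q β n Set.univ • β ≤ (residualLaw Q β n).bind Q := by
  refine Measure.le_iff.2 fun A hA => ?_
  rw [Measure.bind_apply hA (by fun_prop), Measure.smul_apply, smul_eq_mul, mul_comm,
    ← lintegral_const]
  refine lintegral_mono_ae ?_
  have : ∀ᵐ x ∂(residualLaw Q β n), x ∈ E' := by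
    rw [ae_iff]; exact residualLaw_compl Q hQ hβE n hE'
  filter_upwards [this] with x hx using hβ x hx A

include hQ hβ hβE in
lemma residualLaw_succ_add (n : ℕ) (hE' : MeasurableSet E') :
    residualLaw Q β (n + 1) + residualLaw Q β n Set.univ • β = (residualLaw Q β n).bind Q := by
  have : IsFiniteMeasure (residualLaw Q β n Set.univ • β) :=
    β.smul_finite (measure_ne_top _ _)
  exact Measure.sub_add_cancel_of_le (residualLaw_smul_le Q hQ hβ hβE n hE')

-- Every step regenerates with probability β(univ), so the surviving mass decays geometrically.
include hQ hβ hβE in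
lemma residualLaw_univ (n : ℕ) (hE' : MeasurableSet E') :
    residualLaw Q β n Set.univ = β Set.univ * (1 - β Set.univ) ^ n := by
  induction n with
  | zero => simp [residualLaw]
  | succ n ih =>
    have h := congrArg (fun ν : Measure E => ν Set.univ)
      (residualLaw_succ_add Q hQ hβ hβE n hE')
    simp only [Measure.add_apply, Measure.smul_apply, smul_eq_mul,
      Measure.bind_apply MeasurableSet.univ (Kernel.aemeasurable Q), measure_univ,
      lintegral_one] at h
    have hfin : residualLaw Q β n Set.univ * β Set.univ ≠ ∞ :=
      ENNReal.mul_ne_top (measure_ne_top _ _) (measure_ne_top _ _)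
    rw [ENNReal.eq_sub_of_add_eq hfin h, pow_succ, ← mul_assoc, ← ih,
      ENNReal.mul_sub (fun _ _ => measure_ne_top _ _), mul_one]

include hQ hβ hβE in
/-- A Doeblin chain has an invariant probability measure, and this is null on the null sets of the
minorizing measure which the chain cannot enter. -/
theorem exists_invariant (hE' : MeasurableSet E') (hne : E'.Nonempty) (hβ0 : β ≠ 0) :
    ∃ π : Measure E, IsProbabilityMeasure π ∧ π.bind Q = π ∧ β ≤ π ∧ π E'ᶜ = 0 ∧
      ∀ H, MeasurableSet H → β H = 0 → (∀ x ∉ H, Q x H = 0) → π H = 0 := by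
  have hb0 : β Set.univ ≠ 0 := by simpa using hβ0
  have hb1 : β Set.univ ≤ 1 := by
    obtain ⟨x, hx⟩ := hne
    simpa using hβ x hx Set.univ
  have hmass : ∑' n, residualLaw Q β n Set.univ = 1 := by
    simp_rw [residualLaw_univ Q hQ hβ hβE _ hE']
    rw [ENNReal.tsum_mul_left, ENNReal.tsum_geometric,
      ENNReal.sub_sub_cancel ENNReal.one_ne_top hb1,
      ENNReal.mul_inv_cancel hb0 (measure_ne_top _ _)]
  refine ⟨Measure.sum (residualLaw Q β), ⟨?_⟩, ?_, ?_, ?_, ?_⟩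
  · rw [Measure.sum_apply _ MeasurableSet.univ, hmass]
  -- Summing `residualLaw_succ_add` over n: the mass that regenerates adds up to 1 and restores the
  -- missing term β with index 0.
  · ext A hA
    rw [Measure.bind_apply hA (by fun_prop), lintegral_sum_measure, Measure.sum_apply _ hA,
      tsum_eq_zero_add' (f := fun n => residualLaw Q β n A) ENNReal.summable]
    have h : ∀ n, ∫⁻ x, Q x A ∂(residualLaw Q β n) =
        residualLaw Q β (n + 1) A + residualLaw Q β n Set.univ * β A := fun n => by
      rw [← Measure.bind_apply hA (by fun_prop), ← residualLaw_succ_add Q hQ hβ hβE n hE']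
      simp
    simp_rw [h]
    rw [ENNReal.tsum_add, ENNReal.tsum_mul_right, hmass, one_mul, add_comm]
    rfl
  · exact Measure.le_sum (residualLaw Q β) 0
  · rw [Measure.sum_apply _ hE'.compl]
    simp [residualLaw_compl Q hQ hβE _ hE']
  -- Each residual law is null on H by induction, since it is dominated by one step from the
  -- previous one.
  · intro H hH hβH hQH
    rw [Measure.sum_apply _ hH, ENNReal.tsum_eq_zero]
    intro n
    induction n with
    | zero => exact hβH
    | succ n ih =>
      refine le_antisymm ((Measure.sub_le _).trans ?_) bot_le
      rw [Measure.bind_apply hH (by fun_prop)]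
      refine (lintegral_eq_zero_of_ae_eq_zero ?_).le
      have : ∀ᵐ x ∂(residualLaw Q β n), x ∉ H := by rw [ae_iff]; simpa using ih
      filter_upwards [this] with x hx using hQH x hx

end Doeblin

lemma integral_bind_kernel {E F : Type*} [MeasurableSpace E] [MeasurableSpace F] {μ : Measure E}
    (κ : Kernel E F) [IsSFiniteKernel κ] [SFinite μ] {f : F → ℝ} (hf : Integrable f (μ.bind κ)) :
    ∫ y, f y ∂(μ.bind κ) = ∫ x, ∫ y, f y ∂(κ x) ∂μ := by
  have h := Measure.comp_eq_comp_const_apply (κ := κ) (μ := μ)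
  rw [h] at hf
  rw [h, Kernel.integral_comp hf, Kernel.const_apply]

lemma walk_zero (s : ℝ) (x : ℕ → ℝ) : walk s x 0 = s := by simp [walk]

lemma walk_succ (s : ℝ) (x : ℕ → ℝ) (n : ℕ) : walk s x (n + 1) = walk s x n + x (n + 1) := by
  rw [walk, walk, Finset.sum_Icc_succ_top (by omega), add_assoc]

lemma walk_add (s : ℝ) (x : ℕ → ℝ) (m k : ℕ) :
    walk s x (m + k) = walk (walk s x m) (fun j => x (m + j)) k := by
  induction k with
  | zero => rw [walk_zero, add_zero]
  | succ k ih => rw [← add_assoc, walk_succ, ih, walk_succ]; rfl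

lemma walk_start (s : ℝ) (x : ℕ → ℝ) (n : ℕ) : walk s x n = s + walk 0 x n := by
  simp [walk]

/-! ### Recurrence: a centred walk over a Doeblin chain is unbounded -/

section Recurrence

variable {E : Type*} [MeasurableSpace E]

lemma measurable_walk {f : E → ℝ} (hf : Measurable f) (s : ℝ) (n : ℕ) :
    Measurable fun x : ℕ → E => walk s (fun k => f (x k)) n := by
  unfold walk
  fun_prop

/-- The paths along which the walk with increments `f` is bounded below. -/
def boundedPaths (f : E → ℝ) : Set (ℕ → E) :=
  {x | BddAbove (Set.range fun k => -walk 0 (fun j => f (x j)) k)}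

/-- The depth of the minimum of the walk below its start. -/
noncomputable def depth (f : E → ℝ) (x : ℕ → E) : ℝ := ⨆ k, -walk 0 (fun j => f (x j)) k

variable {f : E → ℝ}

lemma measurableSet_boundedPaths (hf : Measurable f) : MeasurableSet (boundedPaths f) :=
  measurableSet_bddAbove_range fun k => (measurable_walk hf 0 k).neg

lemma measurable_depth (hf : Measurable f) : Measurable (depth f) :=
  Measurable.iSup fun k => (measurable_walk hf 0 k).neg

omit [MeasurableSpace E] in
lemma neg_walk_succ_shift (f : E → ℝ) (x : ℕ → E) (k : ℕ) :
    -walk 0 (fun j => f (x j)) (k + 1) =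
      -walk 0 (fun j => f (shiftPath 1 x j)) k - f (x 1) := by
  rw [add_comm, walk_add, walk_start, walk_succ, walk_zero]
  simp only [shiftPath]
  ring_nf

omit [MeasurableSpace E] in
lemma shift_mem_boundedPaths (f : E → ℝ) (x : ℕ → E) :
    shiftPath 1 x ∈ boundedPaths f ↔ x ∈ boundedPaths f := by
  constructor
  · rintro ⟨B, hB⟩
    refine ⟨max 0 (B - f (x 1)), ?_⟩
    rintro _ ⟨k, rfl⟩
    cases k with
    | zero => simp [walk_zero]
    | succ k =>
      have h1 := hB ⟨k, rfl⟩
      have h2 := neg_walk_succ_shift f x k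
      refine le_max_of_le_right ?_
      simp only at h1 ⊢
      linarith
  · rintro ⟨B, hB⟩
    refine ⟨B + f (x 1), ?_⟩
    rintro _ ⟨k, rfl⟩
    have h1 := hB ⟨k + 1, rfl⟩
    have h2 := neg_walk_succ_shift f x k
    simp only at h1 ⊢
    linarith

omit [MeasurableSpace E] in
lemma depth_nonneg {x : ℕ → E} (hx : x ∈ boundedPaths f) : 0 ≤ depth f x := by
  have h : -walk 0 (fun j => f (x j)) 0 ≤ depth f x := le_ciSup hx 0
  simpa [walk_zero] using h

-- Lindley recursion: the infimum is governed either by the start or by the walk after its first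
-- step.
omit [MeasurableSpace E] in
lemma depth_eq {x : ℕ → E} (hx : x ∈ boundedPaths f) :
    depth f x = max 0 (depth f (shiftPath 1 x) - f (x 1)) := by
  have hy := (shift_mem_boundedPaths f x).2 hx
  apply le_antisymm
  · refine ciSup_le fun k => ?_
    cases k with
    | zero => simp [walk_zero]
    | succ k =>
      rw [neg_walk_succ_shift]
      exact le_max_of_le_right (sub_le_sub_right (le_ciSup hy k) _)
  · refine max_le (depth_nonneg hx) ?_
    rw [sub_le_iff_le_add]
    refine ciSup_le fun k => ?_
    have h1 : -walk 0 (fun j => f (x j)) (k + 1) ≤ depth f x := le_ciSup hx (k + 1)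
    have h2 := neg_walk_succ_shift f x k
    linarith

variable (P : Kernel E E) [IsMarkovKernel P] {β : Measure E} [IsFiniteMeasure β]

lemma bind_pathKernel_map_shift (π : Measure E) :
    (π.bind (pathKernel P)).map (shiftPath 1) = (π.bind P).bind (pathKernel P) := by
  rw [Measure.map_comp _ _ (measurable_shiftPath 1),
    Measure.bind_bind P.aemeasurable (pathKernel P).aemeasurable]
  refine Measure.bind_congr_right (Eventually.of_forall fun x => ?_)
  rw [Kernel.map_apply _ (measurable_shiftPath 1), pathKernel_map_shift_one]

lemma bind_pathKernel_map_zero (π : Measure E) :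
    (π.bind (pathKernel P)).map (fun y => y 0) = π := by
  rw [Measure.map_comp _ _ (measurable_pi_apply 0)]
  conv_rhs => rw [← Measure.bind_dirac (m := π)]
  refine Measure.bind_congr_right (Eventually.of_forall fun x => ?_)
  rw [Kernel.map_apply _ (measurable_pi_apply 0), pathKernel_map_zero]

/-- Bounded harmonic functions of a Doeblin chain are constant. -/
lemma harmonic_const (hβ : ∀ x, β ≤ P x) (hβ0 : β ≠ 0) {h : E → ℝ} (hh : Measurable h)
    (h01 : ∀ x, 0 ≤ h x ∧ h x ≤ 1) (hharm : ∀ x, ∫ y, h y ∂(P x) = h x) (x y : E) :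
    h x = h y := by
  have hb0 : 0 < β.real Set.univ := by
    rw [measureReal_def, ENNReal.toReal_pos_iff]
    exact ⟨pos_iff_ne_zero.2 (by simpa using hβ0), measure_lt_top _ _⟩
  have hb1 : β.real Set.univ ≤ 1 := by
    have := ENNReal.toReal_mono (by simp) (hβ x Set.univ)
    simpa [measureReal_def] using this
  -- Since h equals its own average under P, the contraction can be applied to h repeatedly.
  have key : ∀ n : ℕ, ∃ m, ∀ x, m ≤ h x ∧ h x ≤ m + (1 - β.real Set.univ) ^ n := by
    intro n
    induction n with
    | zero => exact ⟨0, by simpa using h01⟩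
    | succ n ih =>
      obtain ⟨m, hm⟩ := ih
      obtain ⟨m', hm'⟩ := doeblin_integral (E' := Set.univ) (D' := Set.univ) P (by simp)
        (fun x _ => hβ x) hh (fun x _ => hm x)
      refine ⟨m', fun x => ?_⟩
      have := hm' x trivial
      rw [hharm] at this
      rwa [pow_succ, mul_comm]
  have hlim : Tendsto (fun n : ℕ => (1 - β.real Set.univ) ^ n) atTop (𝓝 0) :=
    tendsto_pow_atTop_nhds_zero_of_lt_one (by linarith) (by linarith)
  have hle : |h x - h y| ≤ 0 := by
    refine ge_of_tendsto' hlim fun n => ?_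
    obtain ⟨m, hm⟩ := key n
    rw [abs_le]
    constructor <;> linarith [(hm x).1, (hm x).2, (hm y).1, (hm y).2]
  have := abs_nonpos_iff.1 hle
  linarith

/-- As D need not be integrable, the recursion is truncated at K. By invariance of m and I the two
truncated sides have equal integrals once θ is removed. Their difference is dominated by |g| and
converges to D - max(0, D - g) = min(D, g). -/
lemma integral_min_sub_eq_zero {Ω : Type*} [MeasurableSpace Ω] {m : Measure Ω}
    [IsFiniteMeasure m] {θ : Ω → Ω} (hθ : Measurable θ) (hm : m.map θ = m) {I : Set Ω}
    (hI : MeasurableSet I) (hIθ : ∀ x, θ x ∈ I ↔ x ∈ I) {D g : Ω → ℝ} (hD : Measurable D)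
    (hg : Integrable g m) (hgm : Measurable g) (hD0 : ∀ x ∈ I, 0 ≤ D x)
    (hDθ : ∀ x ∈ I, D x = max 0 (D (θ x) - g (θ x))) :
    ∫ x in I, min (D x) (g x) ∂m = 0 := by
  have hK : ∀ K : ℕ, ∫ x in I, (min (D x) K - min (max 0 (D x - g x)) K) ∂m = 0 := by
    intro K
    have hb1 : Integrable (fun x => min (D x) K) (m.restrict I) := by
      refine Integrable.of_bound (C := K) (by fun_prop) ?_
      filter_upwards [ae_restrict_mem hI] with x hx
      rw [Real.norm_of_nonneg (le_min (hD0 x hx) (by positivity))]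
      exact min_le_right _ _
    have hb2 : Integrable (fun x => min (max 0 (D x - g x)) (K : ℝ)) (m.restrict I) := by
      refine Integrable.of_bound (C := K) (by fun_prop) ?_
      refine Eventually.of_forall fun x => ?_
      rw [Real.norm_of_nonneg (le_min (le_max_left _ _) (by positivity))]
      exact min_le_right _ _
    rw [integral_sub hb1 hb2, sub_eq_zero]
    have e : ∫ x in I, min (max 0 (D x - g x)) (K : ℝ) ∂m =
        ∫ x in θ ⁻¹' I, min (max 0 (D (θ x) - g (θ x))) (K : ℝ) ∂m := by
      conv_lhs => rw [← hm]
      exact setIntegral_map (f := fun x => min (max 0 (D x - g x)) (K : ℝ)) hI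
        (Measurable.aestronglyMeasurable (by fun_prop)) hθ.aemeasurable
    have e2 : θ ⁻¹' I = I := by ext x; exact hIθ x
    rw [e, e2]
    refine setIntegral_congr_fun hI fun x hx => ?_
    rw [← hDθ x hx]
  have hlim : Tendsto (fun K : ℕ => ∫ x in I, (min (D x) K - min (max 0 (D x - g x)) K) ∂m)
      atTop (𝓝 (∫ x in I, min (D x) (g x) ∂m)) := by
    refine tendsto_integral_of_dominated_convergence (fun x => |g x|) (fun K => by fun_prop)
      hg.abs.integrableOn (fun K => ?_) ?_
    · filter_upwards [ae_restrict_mem hI] with x hx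
      have h0 := hD0 x hx
      rw [Real.norm_eq_abs]
      refine (abs_min_sub_min_le_max _ _ _ _).trans ?_
      rw [sub_self, abs_zero, max_eq_left (abs_nonneg _)]
      rcases max_cases 0 (D x - g x) with h1 | h1 <;> rw [h1.1] <;>
        rcases abs_cases (g x) with h2 | h2 <;> rw [abs_le] <;> constructor <;> linarith
    · filter_upwards [ae_restrict_mem hI] with x hx
      have h0 := hD0 x hx
      refine tendsto_const_nhds.congr' ?_
      obtain ⟨N, hN⟩ := exists_nat_ge (max (D x) (max 0 (D x - g x)))
      filter_upwards [eventually_ge_atTop N] with K hKN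
      have hNK : (N : ℝ) ≤ K := by exact_mod_cast hKN
      rw [min_eq_left ((le_max_left _ _).trans (hN.trans hNK)),
        min_eq_left ((le_max_right _ _).trans (hN.trans hNK))]
      rcases max_cases 0 (D x - g x) with h1 | h1 <;>
        rcases min_cases (D x) (g x) with h2 | h2 <;> rw [h1.1, h2.1] <;> linarith
  simp_rw [hK] at hlim
  exact (tendsto_nhds_unique tendsto_const_nhds hlim).symm

/-- A walk with conditionally centred increments over a Doeblin chain is unbounded below. -/
theorem ae_not_mem_boundedPaths [MeasurableSingletonClass E] [Nonempty E]
    (hf : Measurable f) (hβ : ∀ x, β ≤ P x)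
    {δ : ℝ} (hδ : 0 < δ) (hβ0 : β ≠ 0) (hβf : ∀ᵐ x ∂β, δ ≤ f x) {C : ℝ≥0∞} (hC : C ≠ ∞)
    (hint : ∀ x, ∫⁻ y, ‖f y‖ₑ ∂(P x) ≤ C) (hmean : ∀ x, ∫ y, f y ∂(P x) = 0) (x : E) :
    ∀ᵐ y ∂(pathKernel P x), y ∉ boundedPaths f := by
  set I := boundedPaths f with hIdef
  have hI : MeasurableSet I := measurableSet_boundedPaths hf
  let h : E → ℝ := fun x => (pathKernel P x).real I
  have hh : Measurable h := (Kernel.measurable_coe _ hI).ennreal_toReal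
  have hharm : ∀ x, ∫ y, h y ∂(P x) = h x := by
    intro x
    have h1 : pathKernel P x I = ∫⁻ y, pathKernel P y I ∂(P x) := by
      rw [← Measure.bind_apply hI (by fun_prop), ← pathKernel_map_shift_one,
        Measure.map_apply (by fun_prop) hI]
      congr 1
      ext y
      exact (shift_mem_boundedPaths f y).symm
    change ∫ y, (pathKernel P y I).toReal ∂(P x) = (pathKernel P x I).toReal
    rw [h1, integral_toReal (Kernel.measurable_coe _ hI).aemeasurable
      (Eventually.of_forall fun _ => measure_lt_top _ _)]
  have hconst : ∀ z, h z = h x := fun z =>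
    harmonic_const P hβ hβ0 hh (fun x => ⟨measureReal_nonneg, measureReal_le_one⟩) hharm z x
  obtain ⟨π, hπ, hπP, hβπ, -, -⟩ := exists_invariant P (E' := Set.univ) (β := β) (by simp)
    (fun x _ => hβ x) (by simp) MeasurableSet.univ ⟨x, trivial⟩ hβ0
  set m := π.bind (pathKernel P) with hm
  have hmθ : m.map (shiftPath 1) = m := by rw [hm, bind_pathKernel_map_shift, hπP]
  have hm0 : m.map (fun y => y 0) = π := bind_pathKernel_map_zero P π
  have hfπ : Integrable f π := by
    refine ⟨hf.aestronglyMeasurable, ?_⟩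
    rw [HasFiniteIntegral, ← hπP, Measure.lintegral_bind (by fun_prop) (by fun_prop)]
    refine (lintegral_mono hint).trans_lt ?_
    simpa using hC.lt_top
  have hf0 : Integrable (fun y : ℕ → E => f (y 0)) m := by
    rw [← hm0] at hfπ
    exact hfπ.comp_measurable (measurable_pi_apply 0)
  have hfπ0 : ∫ x, f x ∂π = 0 := by
    rw [← hπP] at hfπ ⊢
    rw [integral_bind_kernel P hfπ]
    simp [hmean]
  have hstep : ∀ y ∈ I, depth f y =
      max 0 (depth f (shiftPath 1 y) - f (shiftPath 1 y 0)) := fun y hy => depth_eq hy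
  have hz := integral_min_sub_eq_zero (m := m) (g := fun y => f (y 0)) (measurable_shiftPath 1)
    hmθ hI (shift_mem_boundedPaths f) (measurable_depth hf) hf0 (by fun_prop)
    (fun y hy => depth_nonneg hy) hstep
  -- Given the starting state z the integral over I is h z * f z, and h is constant, so the mean of
  -- f under π remains as a factor.
  have hz2 : ∫ y in I, f (y 0) ∂m = 0 := by
    rw [← integral_indicator hI, hm, integral_bind_kernel _ (hf0.indicator hI)]
    have : ∀ z, ∫ y, I.indicator (fun y => f (y 0)) y ∂(pathKernel P z) = h x * f z := by
      intro z
      have : ∀ᵐ y ∂(pathKernel P z), I.indicator (fun y => f (y 0)) y =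
          I.indicator (fun _ => f z) y := by
        filter_upwards [ae_pathKernel_zero P z] with y hy
        simp [Set.indicator, hy]
      rw [integral_congr_ae this, integral_indicator hI, setIntegral_const, ← hconst z]
      rfl
    simp_rw [this]
    rw [integral_const_mul, hfπ0, mul_zero]
  have hmin : IntegrableOn (fun y => min (depth f y) (f (y 0))) I m := by
    refine Integrable.mono' hf0.abs.integrableOn
      ((measurable_depth hf).min (by fun_prop)).aestronglyMeasurable ?_
    filter_upwards [ae_restrict_mem hI] with y hy
    have := depth_nonneg hy
    rw [Real.norm_eq_abs]
    rcases min_cases (depth f y) (f (y 0)) with h2 | h2 <;> rw [h2.1]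
    rcases abs_cases (f (y 0)) with h3 | h3 <;> rw [abs_le] <;> constructor <;> linarith
  -- The nonnegative function f(y 0) - min(depth, f(y 0)) has integral zero over I. So the maximum
  -- in the Lindley recursion is attained at its second argument.
  have hdepth : ∀ᵐ y ∂m, y ∈ I → f (y 0) ≤ depth f y := by
    have h1 : ∫ y in I, (f (y 0) - min (depth f y) (f (y 0))) ∂m = 0 := by
      rw [integral_sub hf0.integrableOn hmin, hz, hz2, sub_zero]
    rw [setIntegral_eq_zero_iff_of_nonneg_ae
      (Eventually.of_forall fun y => sub_nonneg.2 (min_le_right _ _))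
      (hf0.integrableOn.sub hmin)] at h1
    rw [EventuallyEq, ae_restrict_iff' hI] at h1
    filter_upwards [h1] with y hy hyI
    have := hy hyI
    simp only [Pi.zero_apply, sub_eq_zero] at this
    rw [this]
    exact min_le_left _ _
  have hdepth' : ∀ᵐ y ∂m, y ∈ I → depth f (shiftPath 1 y) = depth f y + f (y 1) := by
    rw [← hmθ] at hdepth
    filter_upwards [ae_of_ae_map (by fun_prop) hdepth] with y hy hyI
    have h1 := hy ((shift_mem_boundedPaths f y).2 hyI)
    have h2 := hstep y hyI
    have e : shiftPath 1 y 0 = y 1 := rfl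
    rw [e] at h1 h2
    rw [max_eq_right (by linarith)] at h2
    linarith
  set mβ := β.bind (pathKernel P) with hmβ
  have hac : mβ ≪ m := (Measure.absolutelyContinuous_of_le hβπ).comp_right (pathKernel P)
  -- One step from β dominates β(univ) times β, hence charges whatever β charges.
  have hacθ : mβ ≪ mβ.map (shiftPath 1) := by
    rw [hmβ, bind_pathKernel_map_shift]
    refine Measure.AbsolutelyContinuous.comp_right ?_ (pathKernel P)
    refine Measure.AbsolutelyContinuous.mk fun A hA hA0 => ?_
    rw [Measure.bind_apply hA (by fun_prop)] at hA0
    have h1 : ∫⁻ _, β A ∂β ≤ 0 := hA0 ▸ lintegral_mono fun z => hβ z A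
    rw [lintegral_const] at h1
    have h2 := nonpos_iff_eq_zero.1 h1
    rcases mul_eq_zero.1 h2 with h3 | h3
    · exact h3
    · exact absurd (by simpa using h3) hβ0
  have hβ0f : ∀ᵐ y ∂mβ, δ ≤ f (y 0) := by
    refine ae_of_ae_map (f := fun y : ℕ → E => y 0) (p := fun z : E => δ ≤ f z)
      (measurable_pi_apply 0).aemeasurable ?_
    rw [hmβ, bind_pathKernel_map_zero]
    exact hβf
  -- A shift adds f(y 1) to the depth, so a bound n * δ turns into (n + 1) * δ for shifted paths
  -- whose initial f is at least δ. By `hacθ` the conclusion returns to paths started from β, where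
  -- f(y 0) ≥ δ.
  have hind : ∀ n : ℕ, ∀ᵐ y ∂mβ, y ∈ I → n * δ ≤ depth f y := by
    intro n
    induction n with
    | zero => exact Eventually.of_forall fun y hy => by simpa using depth_nonneg hy
    | succ n ih =>
      have h1 : ∀ᵐ y ∂(mβ.map (shiftPath 1)), y ∈ I → δ ≤ f (y 0) →
          ((n + 1 : ℕ) : ℝ) * δ ≤ depth f y := by
        have hmeas : MeasurableSet {y : ℕ → E | y ∈ I → δ ≤ f (y 0) →
            ((n + 1 : ℕ) : ℝ) * δ ≤ depth f y} := by
          have m1 : MeasurableSet {y : ℕ → E | δ ≤ f (y 0)} :=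
            measurableSet_le measurable_const (by fun_prop)
          have m2 : MeasurableSet {y : ℕ → E | ((n + 1 : ℕ) : ℝ) * δ ≤ depth f y} :=
            measurableSet_le measurable_const (measurable_depth hf)
          exact hI.imp (m1.imp m2)
        rw [ae_map_iff (by fun_prop) hmeas]
        filter_upwards [ih, hac.ae_le hdepth'] with y hy1 hy2 hyI hyf
        have hyI' := (shift_mem_boundedPaths f y).1 hyI
        have e : shiftPath 1 y 0 = y 1 := rfl
        rw [e] at hyf
        rw [hy2 hyI']
        push_cast
        linarith [hy1 hyI']
      filter_upwards [hacθ.ae_le h1, hβ0f] with y hy1 hy2 hyI using hy1 hyI hy2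
  have hnot : ∀ᵐ y ∂mβ, y ∉ I := by
    filter_upwards [ae_all_iff.2 hind] with y hy hyI
    obtain ⟨n, hn⟩ := exists_nat_gt (depth f y / δ)
    rw [div_lt_iff₀ hδ] at hn
    exact absurd (hy n hyI) (not_le.2 hn)
  have h2 := Measure.ae_ae_of_ae_comp hnot
  have hne : (ae β).NeBot := ae_neBot.2 hβ0
  obtain ⟨z, hz⟩ := h2.exists
  have hz0 : h z = 0 := by
    have h3 : pathKernel P z I = 0 := by simpa [ae_iff] using hz
    simp [h, measureReal_def, h3]
  have hx0 : h x = 0 := by rw [← hconst z, hz0]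
  rw [ae_iff]
  have h4 : (pathKernel P x I).toReal = 0 := hx0
  rw [ENNReal.toReal_eq_zero_iff] at h4
  simpa using h4

omit [MeasurableSpace E] in
lemma exists_walk_lt_of_not_mem {x : ℕ → E} (hx : x ∉ boundedPaths f) (s r : ℝ) (m : ℕ) :
    ∃ k > m, walk s (fun j => f (x j)) k < r := by
  by_contra hcon
  push Not at hcon
  refine hx ⟨∑ k ∈ Finset.range (m + 1), |walk 0 (fun j => f (x j)) k| + |s - r|, ?_⟩
  rintro _ ⟨k, rfl⟩
  simp only
  have hsum : 0 ≤ ∑ k ∈ Finset.range (m + 1), |walk 0 (fun j => f (x j)) k| :=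
    Finset.sum_nonneg fun _ _ => abs_nonneg _
  rcases le_or_gt k m with hk | hk
  · have h1 : |walk 0 (fun j => f (x j)) k| ≤
        ∑ k ∈ Finset.range (m + 1), |walk 0 (fun j => f (x j)) k| :=
      Finset.single_le_sum (f := fun k => |walk 0 (fun j => f (x j)) k|)
        (fun _ _ => abs_nonneg _) (Finset.mem_range.2 (by omega))
    linarith [neg_abs_le (walk 0 (fun j => f (x j)) k), abs_nonneg (s - r)]
  · have h1 := hcon k hk
    rw [walk_start] at h1
    linarith [le_abs_self (s - r)]

end Recurrence

/-! ### A law of large numbers from second moments -/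

section LawOfLargeNumbers

/-- Averages of bounded variables whose partial sums have linearly growing second moments tend
to zero. -/
theorem ae_tendsto_average_zero {Ω : Type*} [MeasurableSpace Ω] {μ : Measure Ω}
    [IsProbabilityMeasure μ] {ξ : ℕ → Ω → ℝ} (hξ : ∀ i, Measurable (ξ i)) {L B : ℝ}
    (hL : ∀ i ω, |ξ i ω| ≤ L)
    (hB : ∀ n : ℕ, ∫ ω, (∑ i ∈ Finset.range n, ξ i ω) ^ 2 ∂μ ≤ B * n) :
    ∀ᵐ ω ∂μ, Tendsto (fun n : ℕ => (∑ i ∈ Finset.range n, ξ i ω) / (n : ℝ)) atTop (𝓝 0) := by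
  set S : ℕ → Ω → ℝ := fun n ω => ∑ i ∈ Finset.range n, ξ i ω with hS
  have hSm : ∀ n, Measurable (S n) := fun n => by fun_prop
  have hSb : ∀ n ω, |S n ω| ≤ n * L := fun n ω => by
    refine (Finset.abs_sum_le_sum_abs _ _).trans ?_
    refine (Finset.sum_le_sum fun i _ => hL i ω).trans ?_
    simp
  have hL0 : ∀ ω, 0 ≤ L := fun ω => (abs_nonneg _).trans (hL 0 ω)
  -- Along the squares the normalized second moments are at most B / m ^ 2, hence summable, so
  -- almost surely the series of Y converges and its terms vanish.
  let Y : ℕ → Ω → ℝ≥0∞ := fun m ω => ENNReal.ofReal ((S (m ^ 2) ω / (m ^ 2 : ℝ)) ^ 2)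
  have hYm : ∀ m, Measurable (Y m) := fun m => by fun_prop
  have hY : ∀ m, ∫⁻ ω, Y m ω ∂μ ≤ ENNReal.ofReal (B / (m : ℝ) ^ 2) := by
    intro m
    have hi : Integrable (fun ω => (S (m ^ 2) ω / (m ^ 2 : ℝ)) ^ 2) μ := by
      refine Integrable.of_bound (C := (((m ^ 2 : ℕ) : ℝ) * L / (m ^ 2 : ℝ)) ^ 2)
        (by fun_prop) (Eventually.of_forall fun ω => ?_)
      rw [Real.norm_eq_abs, abs_pow, abs_div, abs_of_nonneg (by positivity : (0 : ℝ) ≤ m ^ 2)]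
      have := hSb (m ^ 2) ω
      gcongr
    rw [← ofReal_integral_eq_lintegral_ofReal hi (Eventually.of_forall fun ω => sq_nonneg _)]
    refine ENNReal.ofReal_le_ofReal ?_
    simp_rw [div_pow]
    rw [integral_div]
    rcases Nat.eq_zero_or_pos m with rfl | hm
    · simp
    · have := hB (m ^ 2)
      have hm' : (0 : ℝ) < m := by exact_mod_cast hm
      rw [div_le_div_iff₀ (by positivity) (by positivity)]
      push_cast at this
      calc (∫ ω, S (m ^ 2) ω ^ 2 ∂μ) * (m : ℝ) ^ 2 ≤ (B * (m : ℝ) ^ 2) * (m : ℝ) ^ 2 := by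
            gcongr
        _ = B * ((m : ℝ) ^ 2) ^ 2 := by ring
  have hsum : ∑' m, ∫⁻ ω, Y m ω ∂μ ≠ ∞ := by
    refine ne_top_of_le_ne_top ?_ (ENNReal.tsum_le_tsum hY)
    have hs : Summable fun m : ℕ => B / (m : ℝ) ^ 2 := by
      simp_rw [div_eq_mul_inv]
      exact (Real.summable_nat_pow_inv.2 one_lt_two).mul_left B
    exact hs.tsum_ofReal_ne_top
  rw [← lintegral_tsum fun m => (hYm m).aemeasurable] at hsum
  filter_upwards [ae_lt_top' (Measurable.aemeasurable (Measurable.tsum fun m => hYm m)) hsum]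
    with ω hω
  have h0 : Tendsto (fun m => Y m ω) atTop (𝓝 0) :=
    ENNReal.tendsto_atTop_zero_of_tsum_ne_top hω.ne
  have h1 : Tendsto (fun m : ℕ => (S (m ^ 2) ω / (m ^ 2 : ℝ)) ^ 2) atTop (𝓝 0) := by
    have := (ENNReal.tendsto_toReal ENNReal.zero_ne_top).comp h0
    simp only [ENNReal.toReal_zero] at this
    refine this.congr fun m => ?_
    simp [Y, ENNReal.toReal_ofReal (sq_nonneg _)]
  have h2 : Tendsto (fun m : ℕ => |S (m ^ 2) ω / (m ^ 2 : ℝ)|) atTop (𝓝 0) := by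
    have := h1.sqrt
    simpa [Real.sqrt_sq_eq_abs] using this
  have h3 : Tendsto (fun m : ℕ => |S (m ^ 2) ω / (m ^ 2 : ℝ)| + 2 * L / (m : ℝ)) atTop (𝓝 0) := by
    simpa using h2.add (tendsto_const_div_atTop_nhds_zero_nat (2 * L))
  have hsqrt : Tendsto Nat.sqrt atTop atTop := by
    refine tendsto_atTop_atTop.2 fun b => ⟨b ^ 2, fun a ha => ?_⟩
    exact Nat.le_sqrt'.2 ha
  refine squeeze_zero_norm' ?_ (h3.comp hsqrt)
  filter_upwards [eventually_ge_atTop 1] with n hn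
  simp only [Function.comp_apply]
  set m := Nat.sqrt n with hm
  have hm1 : 1 ≤ m := Nat.le_sqrt'.2 (by simpa using hn)
  have hmn : m ^ 2 ≤ n := Nat.sqrt_le' n
  have hnm : n ≤ m ^ 2 + 2 * m := by
    have := Nat.sqrt_le_add n
    rw [← hm] at this
    nlinarith
  have hm' : (1 : ℝ) ≤ m := by exact_mod_cast hm1
  have hmn' : (m : ℝ) ^ 2 ≤ n := by exact_mod_cast hmn
  -- With m the integer square root of n, at most 2 * m terms of size L separate n from m ^ 2; after
  -- division they cost at most 2 * L / m.
  have hdiff : |S n ω - S (m ^ 2) ω| ≤ 2 * m * L := by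
    have : S n ω - S (m ^ 2) ω = ∑ i ∈ Finset.Ico (m ^ 2) n, ξ i ω := by
      simp only [hS]
      rw [Finset.sum_Ico_eq_sub _ hmn]
    rw [this]
    refine (Finset.abs_sum_le_sum_abs _ _).trans ?_
    refine (Finset.sum_le_sum fun i _ => hL i ω).trans ?_
    rw [Finset.sum_const, Nat.card_Ico, nsmul_eq_mul]
    refine mul_le_mul_of_nonneg_right ?_ (hL0 ω)
    have : n - m ^ 2 ≤ 2 * m := by omega
    exact_mod_cast this
  have hSn : |S n ω| ≤ |S (m ^ 2) ω| + 2 * m * L := by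
    have := abs_add_le (S n ω - S (m ^ 2) ω) (S (m ^ 2) ω)
    rw [sub_add_cancel] at this
    linarith
  rw [norm_div, Real.norm_eq_abs, Real.norm_of_nonneg (Nat.cast_nonneg n)]
  have hpos : (0 : ℝ) < (m : ℝ) ^ 2 := by positivity
  calc |S n ω| / n ≤ (|S (m ^ 2) ω| + 2 * m * L) / (m : ℝ) ^ 2 := by
        have := hL0 ω
        exact div_le_div₀ (by positivity) hSn hpos hmn'
    _ = |S (m ^ 2) ω / (m ^ 2 : ℝ)| + 2 * L / m := by
        rw [abs_div, abs_of_pos hpos]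
        field_simp

end LawOfLargeNumbers

/-! ### Sequences that start afresh through a Doeblin chain -/

section Renewal

variable {V W : Type*} [MeasurableSpace V] [MeasurableSpace W]

/-- The law of a random sequence, as a function of an initial state, which starts afresh after its
first term from a state determined by that term. -/
def Renews (U : Kernel W (ℕ → V)) (g : V → W) (hg : Measurable g) : Prop :=
  ∀ w, (U w).map (fun u => (u 0, shiftPath 1 u)) =
    ((U w).map (fun u => u 0)) ⊗ₘ (U.comap g hg)

variable {U : Kernel W (ℕ → V)} [IsMarkovKernel U] {g : V → W} {hg : Measurable g}

lemma Renews.integral (h : Renews U g hg) (w : W) {G : V → (ℕ → V) → ℝ}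
    (hG : Measurable (Function.uncurry G)) {K : ℝ} (hK : ∀ v u, |G v u| ≤ K) :
    ∫ u, G (u 0) (shiftPath 1 u) ∂(U w) = ∫ u, ∫ u', G (u 0) u' ∂(U (g (u 0))) ∂(U w) := by
  have h1 := congrArg (fun m => ∫ p, Function.uncurry G p ∂m) (h w)
  have : IsProbabilityMeasure ((U w).map fun u => u 0) :=
    Measure.isProbabilityMeasure_map (measurable_pi_apply 0).aemeasurable
  have hi : Integrable (Function.uncurry G)
      (((U w).map (fun u => u 0)) ⊗ₘ (U.comap g hg)) :=
    Integrable.of_bound hG.aestronglyMeasurable K (Eventually.of_forall fun p => hK p.1 p.2)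
  have hm : StronglyMeasurable fun v => ∫ u', G v u' ∂(U.comap g hg v) :=
    hG.stronglyMeasurable.integral_kernel_prod_right
  rw [integral_map (by fun_prop) hG.aestronglyMeasurable, Measure.integral_compProd hi] at h1
  simp only [Function.uncurry_apply_pair] at h1
  rw [h1, integral_map (measurable_pi_apply 0).aemeasurable hm.aestronglyMeasurable]
  rfl

/-- The mean of `f` at the `n`-th term. -/
noncomputable def meanAt (U : Kernel W (ℕ → V)) (f : V → ℝ) (n : ℕ) (w : W) : ℝ :=
  ∫ u, f (u n) ∂(U w)

omit [IsMarkovKernel U] in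
lemma measurable_integral_kernel [IsSFiniteKernel U] {F : (ℕ → V) → ℝ} (hF : Measurable F) :
    Measurable fun w => ∫ u, F u ∂(U w) :=
  (StronglyMeasurable.integral_kernel_prod_right (f := fun (_ : W) u => F u)
    (hF.comp measurable_snd).stronglyMeasurable).measurable

lemma measurable_meanAt {f : V → ℝ} (hf : Measurable f) (n : ℕ) : Measurable (meanAt U f n) :=
  measurable_integral_kernel (by fun_prop)

lemma abs_integral_le_of_forall {Ω : Type*} [MeasurableSpace Ω] {μ : Measure Ω}
    [IsProbabilityMeasure μ] {F : Ω → ℝ} {K : ℝ} (hK : ∀ ω, |F ω| ≤ K) : |∫ ω, F ω ∂μ| ≤ K := by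
  simpa using norm_integral_le_of_norm_le_const (μ := μ) (f := F)
    (Eventually.of_forall fun ω => (Real.norm_eq_abs (F ω)).trans_le (hK ω))

/-- The transition kernel of the states from which the sequence starts afresh. -/
noncomputable def renewalKernel (U : Kernel W (ℕ → V)) (g : V → W) : Kernel W W :=
  U.map fun u => g (u 0)

include hg in
omit [IsMarkovKernel U] in
lemma integral_renewalKernel (w : W) {f : W → ℝ} (hf : Measurable f) :
    ∫ w', f w' ∂(renewalKernel U g w) = ∫ u, f (g (u 0)) ∂(U w) := by
  rw [renewalKernel, Kernel.map_apply _ (by fun_prop),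
    integral_map (Measurable.aemeasurable (by fun_prop)) hf.aestronglyMeasurable]

lemma Renews.meanAt_succ (h : Renews U g hg) {f : V → ℝ} (hf : Measurable f) {K : ℝ}
    (hK : ∀ v, |f v| ≤ K) (n : ℕ) (w : W) :
    meanAt U f (n + 1) w = ∫ w', meanAt U f n w' ∂(renewalKernel U g w) := by
  have := h.integral w (G := fun _ u => f (u n)) (by fun_prop) (fun v u => hK _)
  rw [integral_renewalKernel (hg := hg) w (measurable_meanAt hf n)]
  simp only [meanAt, ← this, shiftPath, add_comm 1 n]

variable {E' : Set W} {β : Measure W} [IsFiniteMeasure β]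

/-- The first renewal brings any initial state into E' without contracting; each later one gains a
factor 1 - β(univ). Hence the exponent n - 1, which is also correct at n = 0 under truncated
subtraction. -/
lemma Renews.meanAt_mem (h : Renews U g hg) (hQ : ∀ w, renewalKernel U g w E'ᶜ = 0)
    (hβ : ∀ w ∈ E', β ≤ renewalKernel U g w) {f : V → ℝ} (hf : Measurable f) {m r : ℝ}
    (hfm : ∀ v, m ≤ f v ∧ f v ≤ m + r) (n : ℕ) :
    ∃ m', ∀ w, m' ≤ meanAt U f n w ∧
      meanAt U f n w ≤ m' + (1 - β.real Set.univ) ^ (n - 1) * r := by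
  have hK : ∀ v, |f v| ≤ |m| + |m + r| := fun v => by
    have := hfm v
    rcases abs_cases (f v) with h1 | h1 <;> rcases abs_cases m with h2 | h2 <;>
      rcases abs_cases (m + r) with h3 | h3 <;> linarith
  have : IsMarkovKernel (renewalKernel U g) := by
    unfold renewalKernel; exact Kernel.IsMarkovKernel.map _ (by fun_prop)
  have h0 : ∀ w, m ≤ meanAt U f 0 w ∧ meanAt U f 0 w ≤ m + r := fun w => by
    have := integral_mem_Icc_of_forall_mem (ν := U w) (E' := Set.univ) (by simp)
      (f := fun u => f (u 0)) (by fun_prop) (fun u _ => hfm (u 0))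
    simpa [meanAt] using this
  have key : ∀ n, ∃ m', ∀ w ∈ E', m' ≤ meanAt U f n w ∧
      meanAt U f n w ≤ m' + (1 - β.real Set.univ) ^ n * r := by
    intro n
    induction n with
    | zero => exact ⟨m, fun w _ => by simpa using h0 w⟩
    | succ n ih =>
      obtain ⟨m₁, hm₁⟩ := ih
      obtain ⟨m', hm'⟩ := doeblin_integral (renewalKernel U g) hQ hβ (measurable_meanAt hf n) hm₁
      refine ⟨m', fun w hw => ?_⟩
      rw [h.meanAt_succ hf hK, pow_succ', mul_assoc]
      exact hm' w hw
  cases n with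
  | zero => exact ⟨m, fun w => by simpa using h0 w⟩
  | succ n =>
    obtain ⟨m₁, hm₁⟩ := key n
    refine ⟨m₁, fun w => ?_⟩
    rw [h.meanAt_succ hf hK]
    have := integral_mem_Icc_of_forall_mem (hQ w) (measurable_meanAt hf n) hm₁
    simpa using this

/-- The correlation of `f` at the terms `i` and `i + k`. -/
noncomputable def corrAt (U : Kernel W (ℕ → V)) (f : V → ℝ) (i k : ℕ) (w : W) : ℝ :=
  ∫ u, f (u i) * f (u (i + k)) ∂(U w)

/-- Renewing after the term i turns the later factor into a mean at index k from a new initial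
state, which c bounds uniformly. -/
lemma Renews.abs_corrAt_le (h : Renews U g hg) {f : V → ℝ} (hf : Measurable f) {K c : ℝ}
    (hK : ∀ v, |f v| ≤ K) (hK0 : 0 ≤ K) (k : ℕ) (hc : ∀ w, |meanAt U f k w| ≤ c) (i : ℕ) (w : W) :
    |corrAt U f i (k + 1) w| ≤ K * c := by
  induction i generalizing w with
  | zero =>
    have h1 := h.integral w (G := fun v u => f v * f (u k)) (by fun_prop) (K := K * K)
      (fun v u => by
        rw [abs_mul]
        exact mul_le_mul (hK _) (hK _) (abs_nonneg _) hK0)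
    have e : corrAt U f 0 (k + 1) w = ∫ u, f (u 0) * meanAt U f k (g (u 0)) ∂(U w) := by
      simp only [integral_const_mul] at h1
      refine Eq.trans ?_ h1
      simp [corrAt, shiftPath, add_comm]
    rw [e]
    refine abs_integral_le_of_forall fun u => ?_
    rw [abs_mul]
    exact mul_le_mul (hK _) (hc _) (abs_nonneg _) hK0
  | succ i ih =>
    have h1 := h.integral w (G := fun _ u => f (u i) * f (u (i + (k + 1)))) (by fun_prop)
      (K := K * K) (fun v u => by
        rw [abs_mul]
        exact mul_le_mul (hK _) (hK _) (abs_nonneg _) hK0)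
    have e : corrAt U f (i + 1) (k + 1) w = ∫ u, corrAt U f i (k + 1) (g (u 0)) ∂(U w) := by
      refine Eq.trans ?_ h1
      simp only [corrAt, shiftPath, add_comm 1 i]
      congr! 5
      omega
    rw [e]
    exact abs_integral_le_of_forall fun u => ih _

/-- Adding a term to the sum creates its square, at most K ^ 2, and cross terms bounded by the K * c
k, with total at most K * s. -/
lemma Renews.integral_sum_sq_le (h : Renews U g hg) {f : V → ℝ} (hf : Measurable f) {K s : ℝ}
    (hK : ∀ v, |f v| ≤ K) (hK0 : 0 ≤ K) {c : ℕ → ℝ} (hc : ∀ k w, |meanAt U f k w| ≤ c k)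
    (hs : ∀ n, ∑ k ∈ Finset.range n, c k ≤ s) (w : W) (n : ℕ) :
    ∫ u, (∑ i ∈ Finset.range n, f (u i)) ^ 2 ∂(U w) ≤ (2 * K * s + K ^ 2) * n := by
  induction n with
  | zero => simp
  | succ n ih =>
    have hsb : ∀ (n : ℕ) (u : ℕ → V), |∑ i ∈ Finset.range n, f (u i)| ≤ n * K := fun n u => by
      refine (Finset.abs_sum_le_sum_abs _ _).trans ?_
      refine (Finset.sum_le_sum fun i _ => hK _).trans ?_
      simp
    have i1 : Integrable (fun u : ℕ → V => (∑ i ∈ Finset.range n, f (u i)) ^ 2) (U w) := by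
      refine Integrable.of_bound (C := (n * K) ^ 2)
        (Measurable.aestronglyMeasurable (by fun_prop)) (Eventually.of_forall fun u => ?_)
      rw [Real.norm_eq_abs, abs_pow]
      exact pow_le_pow_left₀ (abs_nonneg _) (hsb n u) 2
    have i2 : ∀ i k : ℕ, Integrable (fun u : ℕ → V => f (u i) * f (u k)) (U w) := fun i k => by
      refine Integrable.of_bound (C := K * K)
        (Measurable.aestronglyMeasurable (by fun_prop)) (Eventually.of_forall fun u => ?_)
      rw [Real.norm_eq_abs, abs_mul]
      exact mul_le_mul (hK _) (hK _) (abs_nonneg _) hK0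
    have e : ∀ u : ℕ → V, (∑ i ∈ Finset.range (n + 1), f (u i)) ^ 2 =
        (∑ i ∈ Finset.range n, f (u i)) ^ 2 + 2 * ∑ i ∈ Finset.range n, f (u i) * f (u n) +
          f (u n) * f (u n) := fun u => by
      rw [Finset.sum_range_succ, ← Finset.sum_mul]
      ring
    simp_rw [e]
    have i3 : Integrable (fun u : ℕ → V => ∑ i ∈ Finset.range n, f (u i) * f (u n)) (U w) :=
      integrable_finsetSum _ fun i _ => i2 i n
    have i4 : Integrable (fun u : ℕ → V => (∑ i ∈ Finset.range n, f (u i)) ^ 2 +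
        2 * ∑ i ∈ Finset.range n, f (u i) * f (u n)) (U w) := i1.add (i3.const_mul 2)
    rw [integral_add i4 (i2 n n), integral_add i1 (i3.const_mul 2),
      integral_const_mul, integral_finsetSum _ fun i _ => i2 i n]
    have b1 : ∫ u, f (u n) * f (u n) ∂(U w) ≤ K ^ 2 := by
      refine (le_abs_self _).trans (abs_integral_le_of_forall fun u => ?_)
      rw [abs_mul, sq]
      exact mul_le_mul (hK _) (hK _) (abs_nonneg _) hK0
    have b2 : ∑ i ∈ Finset.range n, ∫ u, f (u i) * f (u n) ∂(U w) ≤ K * s := by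
      calc ∑ i ∈ Finset.range n, ∫ u, f (u i) * f (u n) ∂(U w)
          ≤ ∑ i ∈ Finset.range n, K * c (n - 1 - i) := by
            refine Finset.sum_le_sum fun i hi => ?_
            have hi' := Finset.mem_range.1 hi
            have h1 := h.abs_corrAt_le hf hK hK0 (n - 1 - i) (hc _) i w
            rw [corrAt, show i + (n - 1 - i + 1) = n by omega] at h1
            exact (le_abs_self _).trans h1
        _ = K * ∑ i ∈ Finset.range n, c i := by
            rw [← Finset.mul_sum, Finset.sum_range_reflect]
        _ ≤ K * s := mul_le_mul_of_nonneg_left (hs n) hK0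
    push_cast
    linarith

/-- A sequence that renews through a Doeblin chain converges geometrically fast in total variation
to a stationary law and satisfies the law of large numbers, uniformly in the initial state. -/
theorem Renews.exists_stationary (h : Renews U g hg) (hQ : ∀ w, renewalKernel U g w E'ᶜ = 0)
    (hβ : ∀ w ∈ E', β ≤ renewalKernel U g w) (hE' : MeasurableSet E') (hne : E'.Nonempty)
    (hβ0 : β ≠ 0) :
    ∃ π : Measure W, IsProbabilityMeasure π ∧ π E'ᶜ = 0 ∧
      (∀ H, MeasurableSet H → β H = 0 → (∀ w ∉ H, renewalKernel U g w H = 0) → π H = 0) ∧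
      (∃ κ : ℝ, 0 ≤ κ ∧ κ < 1 ∧ ∀ A, MeasurableSet A → ∀ n w,
        |(U w).real {u | u n ∈ A} - (π.bind (U.map fun u => u 0)).real A| ≤ κ ^ (n - 1)) ∧
      ∀ φ : V → ℝ, Measurable φ → (∃ K, ∀ v, |φ v| ≤ K) → ∀ w, ∀ᵐ u ∂(U w),
        Tendsto (fun n : ℕ => (∑ j ∈ Finset.range n, φ (u j)) / (n : ℝ)) atTop
          (𝓝 (∫ v, φ v ∂(π.bind (U.map fun u => u 0)))) := by
  have hQM : IsMarkovKernel (renewalKernel U g) := by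
    unfold renewalKernel; exact Kernel.IsMarkovKernel.map _ (by fun_prop)
  have hRM : IsMarkovKernel (U.map fun u => u 0) := Kernel.IsMarkovKernel.map _ (by fun_prop)
  obtain ⟨w₀, hw₀⟩ := hne
  have hβE : β E'ᶜ = 0 := le_antisymm ((hβ w₀ hw₀ _).trans (hQ w₀).le) bot_le
  obtain ⟨π, hπ, hπQ, -, hπE, hπH⟩ := exists_invariant (renewalKernel U g) hQ hβ hβE hE'
    ⟨w₀, hw₀⟩ hβ0
  have hb0 : 0 < β.real Set.univ := by
    rw [measureReal_def, ENNReal.toReal_pos_iff]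
    exact ⟨pos_iff_ne_zero.2 (by simpa using hβ0), measure_lt_top _ _⟩
  have hb1 : β.real Set.univ ≤ 1 := by
    have := ENNReal.toReal_mono (by simp) (hβ w₀ hw₀ Set.univ)
    simpa [measureReal_def] using this
  set κ := 1 - β.real Set.univ with hκ
  set υ := π.bind (U.map fun u => u 0) with hυ
  -- Since π is invariant for the renewal chain, every term has law υ when the initial state has law
  -- π.
  have hυint : ∀ (f : V → ℝ) (K : ℝ), Measurable f → (∀ v, |f v| ≤ K) → ∀ n,
      ∫ w, meanAt U f n w ∂π = ∫ v, f v ∂υ := by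
    intro f K hf hK n
    induction n with
    | zero =>
      rw [hυ, integral_bind_kernel _ (Integrable.of_bound hf.aestronglyMeasurable K
        (Eventually.of_forall hK))]
      congr 1
      ext w
      rw [Kernel.map_apply _ (by fun_prop),
        integral_map (measurable_pi_apply 0).aemeasurable hf.aestronglyMeasurable]
      rfl
    | succ n ih =>
      rw [← ih]
      conv_rhs => rw [← hπQ]
      rw [integral_bind_kernel _ (Integrable.of_bound
        (measurable_meanAt hf n).aestronglyMeasurable K
        (Eventually.of_forall fun w => abs_integral_le_of_forall fun u => hK _))]
      congr 1
      ext w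
      exact h.meanAt_succ hf hK n w
  have hconv : ∀ (f : V → ℝ) (m r : ℝ), Measurable f → (∀ v, m ≤ f v ∧ f v ≤ m + r) →
      ∀ n w, |meanAt U f n w - ∫ v, f v ∂υ| ≤ κ ^ (n - 1) * r := by
    intro f m r hf hfm n w
    have hK : ∀ v, |f v| ≤ |m| + |m + r| := fun v => by
      have := hfm v
      rcases abs_cases (f v) with h1 | h1 <;> rcases abs_cases m with h2 | h2 <;>
        rcases abs_cases (m + r) with h3 | h3 <;> linarith
    obtain ⟨m', hm'⟩ := h.meanAt_mem hQ hβ hf hfm n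
    -- The π-average lies in the same short interval as each individual value, so they differ by at
    -- most its length.
    have h1 := integral_mem_Icc_of_forall_mem (ν := π) (E' := Set.univ) (by simp)
      (measurable_meanAt (U := U) hf n) (fun w _ => hm' w)
    rw [hυint f _ hf hK n] at h1
    simp only [probReal_univ, mul_one] at h1
    rw [abs_le]
    constructor <;> linarith [h1.1, h1.2, (hm' w).1, (hm' w).2]
  refine ⟨π, hπ, hπE, hπH, ⟨κ, by linarith, by linarith, fun A hA n w => ?_⟩, ?_⟩
  · have h1 := hconv (A.indicator fun _ => 1) 0 1 (measurable_const.indicator hA)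
      (fun v => by by_cases hv : v ∈ A <;> simp [hv]) n w
    rw [integral_indicator hA, mul_one] at h1
    have e : meanAt U (A.indicator fun _ => 1) n w = (U w).real {u | u n ∈ A} := by
      have hm : MeasurableSet {u : ℕ → V | u n ∈ A} := measurable_pi_apply n hA
      rw [meanAt, ← integral_indicator_one hm]
      rfl
    rw [e] at h1
    simpa using h1
  · rintro φ hφ ⟨K, hK⟩ w
    have hK0 : 0 ≤ K := by
      obtain ⟨u⟩ : Nonempty (ℕ → V) := (U w).nonempty_of_neZero
      exact (abs_nonneg _).trans (hK (u 0))
    -- Centring at a makes the means decay geometrically uniformly in the initial state, which is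
    -- the summability needed for the second moment bound.
    set a := ∫ v, φ v ∂υ with ha
    have haK : |a| ≤ K := abs_integral_le_of_forall hK
    have hψK : ∀ v, |φ v - a| ≤ 2 * K := fun v => by
      refine (abs_sub _ _).trans ?_
      linarith [hK v]
    have hmean : ∀ k w, |meanAt U (fun v => φ v - a) k w| ≤ κ ^ (k - 1) * (2 * K) := by
      intro k w
      have h1 := hconv φ (-K) (2 * K) hφ (fun v => by
        have := abs_le.1 (hK v)
        constructor <;> linarith) k w
      have e : meanAt U (fun v => φ v - a) k w = meanAt U φ k w - a := by
        rw [meanAt, integral_sub (Integrable.of_bound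
          (Measurable.aestronglyMeasurable (by fun_prop)) K
          (Eventually.of_forall fun u => hK _)) (integrable_const _)]
        simp [meanAt]
      rwa [e]
    have hκ0 : 0 ≤ κ := by linarith
    have hκ1 : κ < 1 := by linarith
    have hsummable : Summable fun k : ℕ => κ ^ (k - 1) * (2 * K) := by
      refine Summable.mul_right _ ?_
      rw [← summable_nat_add_iff 1]
      simpa using summable_geometric_of_lt_one hκ0 hκ1
    have hsq := h.integral_sum_sq_le (f := fun v => φ v - a) (by fun_prop) hψK (by linarith)
      hmean (fun n => hsummable.sum_le_tsum _ fun k _ => by positivity) w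
    have := ae_tendsto_average_zero (μ := U w) (ξ := fun i u => φ (u i) - a)
      (fun i => by fun_prop) (fun i u => hψK _) hsq
    filter_upwards [this] with u hu
    have h2 := hu.add_const a
    rw [zero_add] at h2
    refine h2.congr' ?_
    filter_upwards [eventually_ge_atTop 1] with n hn
    have hn' : (n : ℝ) ≠ 0 := by positivity
    rw [Finset.sum_sub_distrib]
    simp only [Finset.sum_const, Finset.card_range, nsmul_eq_mul]
    field_simp
    ring

end Renewal

/-! ### Deterministic properties of crossing times -/

section Pathwise

variable {s s' : ℕ → ℝ} {B : Set ℝ} {a b : ℝ}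

lemma firstAfter_eq_top_iff {m : ℕ∞} :
    firstAfter s B m = ⊤ ↔ ∀ k : ℕ, m < k → s k ∉ B := by
  rw [firstAfter, sInf_eq_top]
  constructor
  · intro h k hk hB
    exact ENat.natCast_ne_top k (h _ ⟨k, ⟨hk, hB⟩, rfl⟩)
  · rintro h _ ⟨k, ⟨hk, hB⟩, rfl⟩
    exact absurd hB (h k hk)

lemma firstAfter_eq_coe_iff {m : ℕ∞} {k : ℕ} :
    firstAfter s B m = k ↔ m < k ∧ s k ∈ B ∧ ∀ j < k, m < (j : ℕ∞) → s j ∉ B := by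
  have key : ∀ k : ℕ, (m < k ∧ s k ∈ B ∧ ∀ j < k, m < (j : ℕ∞) → s j ∉ B) →
      firstAfter s B m = k := by
    rintro k ⟨h1, h2, h3⟩
    apply le_antisymm
    · exact sInf_le ⟨k, ⟨h1, h2⟩, rfl⟩
    · refine le_sInf ?_
      rintro _ ⟨j, ⟨hj, hB⟩, rfl⟩
      by_contra hlt
      exact h3 j (Nat.cast_lt.1 (not_le.1 hlt)) hj hB
  refine ⟨fun h => ?_, key k⟩
  classical
  have hex : ∃ k : ℕ, m < (k : ℕ∞) ∧ s k ∈ B := by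
    by_contra hcon
    push Not at hcon
    rw [firstAfter_eq_top_iff.2 hcon] at h
    exact ENat.natCast_ne_top k h.symm
  have hspec := Nat.find_spec hex
  have hf := key (Nat.find hex) ⟨hspec.1, hspec.2, fun j hj hm hB => Nat.find_min hex hj ⟨hm, hB⟩⟩
  have hk : Nat.find hex = k := by
    rw [h] at hf
    exact_mod_cast hf.symm
  rw [← hk]
  exact ⟨hspec.1, hspec.2, fun j hj hm hB => Nat.find_min hex hj ⟨hm, hB⟩⟩

/-- The offset r is allowed to be infinite so that the rule applies again with r itself a hitting
time. -/
lemma firstAfter_add (s : ℕ → ℝ) (B : Set ℝ) (m : ℕ) (r : ℕ∞) :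
    firstAfter s B (m + r) = m + firstAfter (fun k => s (m + k)) B r := by
  have hlt : ∀ k : ℕ, (m + r : ℕ∞) < ((m + k : ℕ) : ℕ∞) ↔ r < k := fun k => by
    push_cast
    exact ENat.add_lt_add_iff_left (ENat.natCast_ne_top m)
  have hge : ∀ k : ℕ, (m + r : ℕ∞) < k → ∃ j, k = m + j := fun k hk => by
    have h1 : (m : ℕ∞) < k := lt_of_le_of_lt le_self_add hk
    have h2 : m < k := by exact_mod_cast h1
    exact ⟨k - m, by omega⟩
  induction h : firstAfter (fun k => s (m + k)) B r using ENat.recTopCoe with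
  | top =>
    rw [add_top, firstAfter_eq_top_iff]
    intro k hk
    obtain ⟨j, rfl⟩ := hge k hk
    exact firstAfter_eq_top_iff.1 h j ((hlt j).1 hk)
  | coe k =>
    rw [← Nat.cast_add, firstAfter_eq_coe_iff]
    obtain ⟨h1, h2, h3⟩ := firstAfter_eq_coe_iff.1 h
    refine ⟨(hlt k).2 h1, h2, fun j hj hm => ?_⟩
    obtain ⟨i, rfl⟩ := hge j hm
    exact h3 i (by omega) ((hlt i).1 hm)

lemma timeL_succ_of_eq {m : ℕ} (h : timeL a b s 1 = m) (n : ℕ) :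
    timeL a b s (n + 1) = m + timeL a b (fun k => s (m + k)) n := by
  induction n with
  | zero => rw [zero_add, h]; simp [timeL]
  | succ n ih =>
    change firstAfter s _ (firstAfter s _ (timeL a b s (n + 1))) = _
    rw [ih, firstAfter_add, firstAfter_add]
    rfl

lemma timeT_succ_of_eq {m : ℕ} (h : timeL a b s 1 = m) (n : ℕ) :
    timeT a b s (n + 2) = m + timeT a b (fun k => s (m + k)) (n + 1) := by
  change firstAfter s _ (timeL a b s (n + 1)) = _
  rw [timeL_succ_of_eq h, firstAfter_add]
  rfl

/-- The sequence is infinitely often below `a` and infinitely often above `b`. -/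
def Oscillates (a b : ℝ) (s : ℕ → ℝ) : Prop :=
  ∀ m : ℕ, (∃ k > m, s k < a) ∧ ∃ k > m, b < s k

lemma Oscillates.firstAfter_Iio_ne_top (h : Oscillates a b s) {m : ℕ∞} (hm : m ≠ ⊤) :
    firstAfter s (Set.Iio a) m ≠ ⊤ := by
  lift m to ℕ using hm
  obtain ⟨k, hk, hs⟩ := (h m).1
  exact fun h' => firstAfter_eq_top_iff.1 h' k (by exact_mod_cast hk) hs

lemma Oscillates.firstAfter_Ioi_ne_top (h : Oscillates a b s) {m : ℕ∞} (hm : m ≠ ⊤) :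
    firstAfter s (Set.Ioi b) m ≠ ⊤ := by
  lift m to ℕ using hm
  obtain ⟨k, hk, hs⟩ := (h m).2
  exact fun h' => firstAfter_eq_top_iff.1 h' k (by exact_mod_cast hk) hs

lemma Oscillates.timeL_ne_top (h : Oscillates a b s) (n : ℕ) : timeL a b s n ≠ ⊤ := by
  induction n with
  | zero => simp [timeL]
  | succ n ih => exact h.firstAfter_Ioi_ne_top (h.firstAfter_Iio_ne_top ih)

lemma Oscillates.timeT_ne_top (h : Oscillates a b s) (n : ℕ) : timeT a b s (n + 1) ≠ ⊤ :=
  h.firstAfter_Iio_ne_top (h.timeL_ne_top n)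

lemma Oscillates.shift (h : Oscillates a b s) (m : ℕ) : Oscillates a b (fun k => s (m + k)) := by
  intro j
  obtain ⟨⟨k, hk, hs⟩, ⟨l, hl, hs'⟩⟩ := h (m + j)
  refine ⟨⟨k - m, by omega, ?_⟩, ⟨l - m, by omega, ?_⟩⟩
  · change s (m + (k - m)) < a
    rwa [show m + (k - m) = k by omega]
  · change b < s (m + (l - m))
    rwa [show m + (l - m) = l by omega]

/-- Oscillation makes all the times finite, without which `ENat.toNat` would not be additive. The
indices start at n + 1 because `timeT` has a placeholder at 0. -/
lemma crossing_shift {s₀ : ℝ} {x : ℕ → ℝ} (h : Oscillates a b (walk s₀ x)) {m : ℕ}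
    (hm : timeL a b (walk s₀ x) 1 = m) (n : ℕ) :
    crossing a b s₀ x (n + 2) =
      crossing a b (walk s₀ x m) (fun k => x (m + k)) (n + 1) := by
  have e : (fun k => walk s₀ x (m + k)) = walk (walk s₀ x m) (fun k => x (m + k)) :=
    funext fun k => walk_add s₀ x m k
  have h' := h.shift m
  have hT := timeT_succ_of_eq hm n
  have hL := timeL_succ_of_eq hm (n + 1)
  rw [e] at h' hT hL
  have e1 : (timeT a b (walk s₀ x) (n + 2)).toNat =
      m + (timeT a b (walk (walk s₀ x m) fun k => x (m + k)) (n + 1)).toNat := by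
    rw [hT, ENat.toNat_add (ENat.natCast_ne_top m) (h'.timeT_ne_top n), ENat.toNat_natCast]
  have e2 : (timeL a b (walk s₀ x) (n + 2)).toNat =
      m + (timeL a b (walk (walk s₀ x m) fun k => x (m + k)) (n + 1)).toNat := by
    rw [show n + 2 = n + 1 + 1 from rfl, hL,
      ENat.toNat_add (ENat.natCast_ne_top m) (h'.timeL_ne_top (n + 1)), ENat.toNat_natCast]
  simp only [crossing, e1, e2, walk_add, Nat.add_sub_add_left]

/-- The first two crossing times in terms of the values of the sequence. -/
lemma timeL_one_eq_coe_iff {l : ℕ} :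
    timeL a b s 1 = l ↔ ∃ t : ℕ, timeT a b s 1 = t ∧ firstAfter s (Set.Ioi b) t = l := by
  constructor
  · intro h
    have h1 : firstAfter s (Set.Ioi b) (timeT a b s 1) = l := h
    have h2 := (firstAfter_eq_coe_iff.1 h1).1
    have h3 : timeT a b s 1 ≠ ⊤ := fun h4 => by simp [h4] at h2
    lift timeT a b s 1 to ℕ using h3 with t ht
    exact ⟨t, rfl, h1⟩
  · rintro ⟨t, ht, hl⟩
    change firstAfter s (Set.Ioi b) (timeT a b s 1) = l
    rw [ht, hl]

lemma firstAfter_congr {m : ℕ∞} {k : ℕ} (h : ∀ i ≤ k, s i = s' i)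
    (hk : firstAfter s B m = k) : firstAfter s' B m = k := by
  obtain ⟨h1, h2, h3⟩ := firstAfter_eq_coe_iff.1 hk
  refine firstAfter_eq_coe_iff.2 ⟨h1, h k le_rfl ▸ h2, fun j hj hm => ?_⟩
  rw [← h j hj.le]
  exact h3 j hj hm

lemma walk_congr {s₀ : ℝ} {x x' : ℕ → ℝ} {k : ℕ} (h : ∀ i ≤ k, x i = x' i) :
    walk s₀ x k = walk s₀ x' k := by
  unfold walk
  congr 1
  exact Finset.sum_congr rfl fun i hi => h i (Finset.mem_Icc.1 hi).2

/-- The first upcrossing time is a stopping time, and the first crossing data are determined by the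
path up to it. -/
lemma crossing_one_congr {s₀ : ℝ} {x x' : ℕ → ℝ} {l : ℕ} (h : ∀ i ≤ l, x i = x' i)
    (hl : timeL a b (walk s₀ x) 1 = l) :
    timeL a b (walk s₀ x') 1 = l ∧ crossing a b s₀ x' 1 = crossing a b s₀ x 1 := by
  have hw : ∀ i ≤ l, walk s₀ x i = walk s₀ x' i := fun i hi =>
    walk_congr fun j hj => h j (hj.trans hi)
  obtain ⟨t, ht, hlt⟩ := timeL_one_eq_coe_iff.1 hl
  have htl : t < l := by exact_mod_cast (firstAfter_eq_coe_iff.1 hlt).1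
  have ht' : timeT a b (walk s₀ x') 1 = t :=
    firstAfter_congr (fun i hi => hw i (hi.trans htl.le)) ht
  have hl' : timeL a b (walk s₀ x') 1 = l :=
    timeL_one_eq_coe_iff.2 ⟨t, ht', firstAfter_congr hw hlt⟩
  refine ⟨hl', ?_⟩
  simp only [crossing, ht, ht', hl, hl', ENat.toNat_natCast]
  rw [h t htl.le, h l le_rfl, hw t htl.le, hw l le_rfl]

/-- What the first crossing data look like when the crossing times are finite. -/
lemma crossing_one_spec {s₀ : ℝ} {x : ℕ → ℝ} {l : ℕ} (hl : timeL a b (walk s₀ x) 1 = l)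
    (hab : a ≤ b) :
    ∃ t j, 1 ≤ t ∧ l = t + j + 1 ∧
      crossing a b s₀ x 1 = (x t, walk s₀ x t, x l, walk s₀ x l, l - t) ∧
      walk s₀ x t < a ∧ b < walk s₀ x l ∧ walk s₀ x (t + j) ≤ b ∧
      (a ≤ s₀ → a ≤ walk s₀ x (t - 1)) := by
  obtain ⟨t, ht, hlt⟩ := timeL_one_eq_coe_iff.1 hl
  obtain ⟨h1, h2, h3⟩ := firstAfter_eq_coe_iff.1 hlt
  have ht' : firstAfter (walk s₀ x) (Set.Iio a) 0 = t := ht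
  obtain ⟨g1, g2, g3⟩ := firstAfter_eq_coe_iff.1 ht'
  have h1' : t < l := by exact_mod_cast h1
  have g1' : 0 < t := by exact_mod_cast g1
  refine ⟨t, l - 1 - t, g1', by omega, ?_, g2, h2, ?_, ?_⟩
  · simp only [crossing, ht, hl, ENat.toNat_natCast]
  · rw [show t + (l - 1 - t) = l - 1 by omega]
    -- Just before the upcrossing the walk is either at the time t, below a, or at a later time when
    -- it has not yet exceeded b.
    rcases (by omega : l - 1 = t ∨ t < l - 1) with h | h
    · rw [h]; exact (le_of_lt g2).trans hab
    · exact not_lt.1 (h3 (l - 1) (by omega) (by exact_mod_cast h))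
  · intro hs
    rcases (by omega : t - 1 = 0 ∨ 0 < t - 1) with h | h
    · rwa [h, walk_zero]
    · exact not_lt.1 (g3 (t - 1) (by omega) (by exact_mod_cast h))

end Pathwise

/-! ### Measurability of the crossing times and data -/

section Measurability

variable {Ω : Type*} [MeasurableSpace Ω]

lemma measurable_firstAfter {S : ℕ → Ω → ℝ} (hS : ∀ k, Measurable (S k)) {B : Set ℝ}
    (hB : MeasurableSet B) {τ : Ω → ℕ∞} (hτ : Measurable τ) :
    Measurable fun ω => firstAfter (fun k => S k ω) B (τ ω) := by
  have h1 : ∀ k : ℕ, MeasurableSet {ω | τ ω < k} := fun k =>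
    hτ (MeasurableSet.of_discrete (s := Set.Iio (k : ℕ∞)))
  have h2 : ∀ k : ℕ, MeasurableSet {ω | S k ω ∈ B} := fun k => hS k hB
  refine measurable_to_countable' fun n => ?_
  induction n using ENat.recTopCoe with
  | top =>
    have : (fun ω => firstAfter (fun k => S k ω) B (τ ω)) ⁻¹' {⊤} =
        ⋂ k : ℕ, {ω | τ ω < k → S k ω ∉ B} := by
      ext ω
      simp only [Set.mem_preimage, Set.mem_iInter, Set.mem_ofPred_eq]
      exact firstAfter_eq_top_iff
    rw [this]
    exact MeasurableSet.iInter fun k => (h1 k).imp (h2 k).compl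
  | coe k =>
    have : (fun ω => firstAfter (fun k => S k ω) B (τ ω)) ⁻¹' {(k : ℕ∞)} =
        {ω | τ ω < k} ∩ ({ω | S k ω ∈ B} ∩
          ⋂ j : ℕ, ⋂ (_ : j < k), {ω | τ ω < j → S j ω ∉ B}) := by
      ext ω
      simp only [Set.mem_preimage, Set.mem_iInter, Set.mem_ofPred_eq, Set.mem_inter_iff]
      exact firstAfter_eq_coe_iff
    rw [this]
    exact (h1 k).inter ((h2 k).inter (MeasurableSet.iInter fun j => MeasurableSet.iInter fun _ =>
      (h1 j).imp (h2 j).compl))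

lemma measurable_timeL {S : ℕ → Ω → ℝ} (hS : ∀ k, Measurable (S k)) (a b : ℝ) (n : ℕ) :
    Measurable fun ω => timeL a b (fun k => S k ω) n := by
  induction n with
  | zero => exact measurable_const
  | succ n ih =>
    exact measurable_firstAfter hS measurableSet_Ioi (measurable_firstAfter hS measurableSet_Iio ih)

lemma measurable_timeT {S : ℕ → Ω → ℝ} (hS : ∀ k, Measurable (S k)) (a b : ℝ) (n : ℕ) :
    Measurable fun ω => timeT a b (fun k => S k ω) n := by
  cases n with
  | zero => exact measurable_const
  | succ n => exact measurable_firstAfter hS measurableSet_Iio (measurable_timeL hS a b n)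

lemma measurable_eval_random {F : Type*} [MeasurableSpace F] {S : ℕ → Ω → F}
    (hS : ∀ k, Measurable (S k)) {τ : Ω → ℕ} (hτ : Measurable τ) :
    Measurable fun ω => S (τ ω) ω := by
  have h : Measurable fun p : ℕ × Ω => S p.1 p.2 :=
    measurable_from_prod_countable_right fun k => hS k
  exact h.comp (hτ.prodMk measurable_id)

lemma measurable_crossing {S₀ : Ω → ℝ} (hS₀ : Measurable S₀) {X : ℕ → Ω → ℝ}
    (hX : ∀ k, Measurable (X k)) (a b : ℝ) (n : ℕ) :
    Measurable fun ω => crossing a b (S₀ ω) (fun k => X k ω) n := by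
  have hS : ∀ k, Measurable fun ω => walk (S₀ ω) (fun k => X k ω) k := fun k => by
    unfold walk; fun_prop
  have hT : Measurable fun ω =>
      (timeT a b (walk (S₀ ω) (fun k => X k ω)) n).toNat :=
    (Measurable.of_discrete (f := ENat.toNat)).comp (measurable_timeT hS a b n)
  have hL : Measurable fun ω =>
      (timeL a b (walk (S₀ ω) (fun k => X k ω)) n).toNat :=
    (Measurable.of_discrete (f := ENat.toNat)).comp (measurable_timeL hS a b n)
  exact (measurable_eval_random hX hT).prodMk ((measurable_eval_random hS hT).prodMk
    ((measurable_eval_random hX hL).prodMk ((measurable_eval_random hS hL).prodMk (hL.sub hT))))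

end Measurability

/-! ### The crossing data start afresh at an upcrossing -/

section Crossing

variable {M : ℝ}

/-- The crossing data of the walk started at `s` with increments along a path. -/
noncomputable def crossingSeq (a b s : ℝ) (y : ℕ → Set.Iic M) : ℕ → ℝ × ℝ × ℝ × ℝ × ℕ :=
  fun n => crossing a b s (fun k => (y k : ℝ)) (n + 1)

lemma measurable_crossingSeq_comp {Ω : Type*} [MeasurableSpace Ω] {S : Ω → ℝ}
    (hS : Measurable S) {Y : Ω → ℕ → Set.Iic M} (hY : Measurable Y) (a b : ℝ) :
    Measurable fun ω => crossingSeq a b (S ω) (Y ω) := by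
  refine measurable_pi_iff.2 fun n => ?_
  refine measurable_crossing hS (fun k => ?_) a b (n + 1)
  exact measurable_subtype_coe.comp ((measurable_pi_apply k).comp hY)

lemma measurable_crossingSeq (a b s : ℝ) :
    Measurable (crossingSeq (M := M) a b s) :=
  measurable_crossingSeq_comp measurable_const measurable_id a b

/-- A retraction of the line onto `(-∞, M]`. -/
noncomputable def toIic (M : ℝ) (v : ℝ) : Set.Iic M := ⟨min v M, min_le_right v M⟩

lemma measurable_toIic : Measurable (toIic M) :=
  (measurable_id.min measurable_const).subtype_mk

lemma toIic_coe (x : Set.Iic M) : toIic M x = x := Subtype.ext (min_eq_left x.2)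

lemma coe_toIic {v : ℝ} (hv : v ≤ M) : (toIic M v : ℝ) = v := min_eq_left hv

/-- The state of the chain and of the walk at an upcrossing. -/
noncomputable def restart (M : ℝ) (u : ℝ × ℝ × ℝ × ℝ × ℕ) : Set.Iic M × ℝ :=
  (toIic M u.2.2.1, u.2.2.2.1)

lemma measurable_restart : Measurable (restart M) :=
  (measurable_toIic.comp (by fun_prop)).prodMk (by fun_prop)

variable (P : Kernel (Set.Iic M) (Set.Iic M)) [IsMarkovKernel P] (a b : ℝ)

/-- The law of the crossing data as a function of the initial state of the chain and the walk. -/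
noncomputable def crossingKernel : Kernel (Set.Iic M × ℝ) (ℕ → ℝ × ℝ × ℝ × ℝ × ℕ) :=
  (Kernel.deterministic (Prod.snd : Set.Iic M × ℝ → ℝ) measurable_snd ×ₖ
    (pathKernel P).comap Prod.fst measurable_fst).map fun p => crossingSeq a b p.1 p.2

lemma measurable_crossingSeq_uncurry :
    Measurable fun p : ℝ × (ℕ → Set.Iic M) => crossingSeq a b p.1 p.2 :=
  measurable_crossingSeq_comp measurable_fst measurable_snd a b

lemma crossingKernel_apply (w : Set.Iic M × ℝ) :
    crossingKernel P a b w = (pathKernel P w.1).map (crossingSeq a b w.2) := by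
  rw [crossingKernel, Kernel.map_apply _ (measurable_crossingSeq_uncurry a b), Kernel.prod_apply,
    Kernel.deterministic_apply, Kernel.comap_apply, Measure.dirac_prod,
    Measure.map_map (measurable_crossingSeq_uncurry a b) (by fun_prop)]
  rfl

instance : IsMarkovKernel (crossingKernel P a b) :=
  Kernel.IsMarkovKernel.map _ (measurable_crossingSeq_uncurry a b)

variable {P a b}

lemma measurableSet_timeL_eq (s : ℝ) (n : ℕ) :
    MeasurableSet {y : ℕ → Set.Iic M | timeL a b (walk s fun k => (y k : ℝ)) 1 = n} := by
  have hm : Measurable fun y : ℕ → Set.Iic M => timeL a b (walk s fun k => (y k : ℝ)) 1 :=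
    measurable_timeL (fun k => measurable_walk (f := fun x : Set.Iic M => (x : ℝ))
      measurable_subtype_coe s k) a b 1
  exact hm (MeasurableSet.of_discrete (s := {(n : ℕ∞)}))

lemma lintegral_eq_tsum_of_ae_partition {Ω : Type*} [MeasurableSpace Ω] {μ : Measure Ω}
    {D : ℕ → Set Ω} (hD : ∀ n, MeasurableSet (D n)) (hd : Pairwise (Function.onFun Disjoint D))
    (hc : ∀ᵐ ω ∂μ, ∃ n, ω ∈ D n) (F : Ω → ℝ≥0∞) :
    ∫⁻ ω, F ω ∂μ = ∑' n, ∫⁻ ω in D n, F ω ∂μ := by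
  rw [← lintegral_iUnion hD hd, Measure.restrict_eq_self_of_ae_mem]
  simpa using hc

lemma restart_crossingSeq {s : ℝ} {y : ℕ → Set.Iic M} {n : ℕ}
    (h : timeL a b (walk s fun k => (y k : ℝ)) 1 = n) :
    restart M (crossingSeq a b s y 0) = (y n, walk s (fun k => (y k : ℝ)) n) := by
  simp only [restart, crossingSeq, crossing, zero_add, h, ENat.toNat_natCast, toIic_coe]

/-- The event that the first upcrossing occurs at time n belongs to the past of n, expressed as
invariance under freezing the path. -/
lemma timeL_stopPath {s : ℝ} {y : ℕ → Set.Iic M} {n : ℕ} :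
    timeL a b (walk s fun k => ((stopPath n y k : Set.Iic M) : ℝ)) 1 = n ↔
      timeL a b (walk s fun k => (y k : ℝ)) 1 = n := by
  have h : ∀ i ≤ n, ((stopPath n y i : Set.Iic M) : ℝ) = y i := fun i hi => by
    simp [stopPath, min_eq_left hi]
  exact ⟨fun h' => (crossing_one_congr h h').1,
    fun h' => (crossing_one_congr (fun i hi => (h i hi).symm) h').1⟩

lemma crossingSeq_stopPath {s : ℝ} {y : ℕ → Set.Iic M} {n : ℕ}
    (h' : timeL a b (walk s fun k => (y k : ℝ)) 1 = n) :
    crossingSeq a b s (stopPath n y) 0 = crossingSeq a b s y 0 := by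
  have h : ∀ i ≤ n, ((stopPath n y i : Set.Iic M) : ℝ) = y i := fun i hi => by
    simp [stopPath, min_eq_left hi]
  exact (crossing_one_congr (fun i hi => (h i hi).symm) h').2

lemma walk_stopPath (s : ℝ) (y : ℕ → Set.Iic M) (n : ℕ) :
    walk s (fun k => ((stopPath n y k : Set.Iic M) : ℝ)) n = walk s (fun k => (y k : ℝ)) n :=
  walk_congr fun i hi => by simp [stopPath, min_eq_left hi]

variable (hosc : ∀ x s, ∀ᵐ y ∂(pathKernel P x), Oscillates a b (walk s fun k => (y k : ℝ)))

include hosc in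
/-- The crossing data start afresh at the first upcrossing. -/
theorem renews_crossingKernel : Renews (crossingKernel P a b) (restart M) measurable_restart := by
  rintro ⟨x, s⟩
  have hU := measurable_crossingSeq (M := M) a b s
  have hprob : IsProbabilityMeasure
      ((crossingKernel P a b (x, s)).map fun u => u 0) :=
    Measure.isProbabilityMeasure_map (measurable_pi_apply 0).aemeasurable
  refine Measure.ext_prod fun {A B} hA hB => ?_
  have hBm := (crossingKernel P a b).measurable_coe hB
  rw [Measure.compProd_apply_prod hA hB,
    setLIntegral_map hA (Kernel.measurable_coe _ hB) (measurable_pi_apply 0),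
    Measure.map_apply (by fun_prop) (hA.prod hB), ← lintegral_indicator_one
      ((by fun_prop : Measurable fun u : ℕ → ℝ × ℝ × ℝ × ℝ × ℕ => (u 0, shiftPath 1 u))
        (hA.prod hB)), ← lintegral_indicator (measurable_pi_apply 0 hA)]
  simp only [Kernel.comap_apply]
  have hm1 : Measurable (((fun u : ℕ → ℝ × ℝ × ℝ × ℝ × ℕ => (u 0, shiftPath 1 u)) ⁻¹'
      A ×ˢ B).indicator (1 : (ℕ → ℝ × ℝ × ℝ × ℝ × ℕ) → ℝ≥0∞)) :=
    measurable_one.indicator ((by fun_prop : Measurable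
      fun u : ℕ → ℝ × ℝ × ℝ × ℝ × ℕ => (u 0, shiftPath 1 u)) (hA.prod hB))
  have hm2 : Measurable (((fun u : ℕ → ℝ × ℝ × ℝ × ℝ × ℕ => u 0) ⁻¹' A).indicator
      fun u => crossingKernel P a b (restart M (u 0)) B) :=
    (hBm.comp (measurable_restart.comp (measurable_pi_apply 0))).indicator
      (measurable_pi_apply 0 hA)
  rw [crossingKernel_apply, lintegral_map hm1 hU, lintegral_map hm2 hU]
  have hd : Pairwise (Function.onFun Disjoint fun n : ℕ =>
      {y : ℕ → Set.Iic M | timeL a b (walk s fun k => (y k : ℝ)) 1 = n}) := by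
    intro m n hmn
    refine Set.disjoint_left.2 fun y hy hy' => hmn ?_
    simp only [Set.mem_ofPred_eq] at hy hy'
    rw [hy] at hy'
    exact_mod_cast hy'
  have hc : ∀ᵐ y ∂(pathKernel P x), ∃ n : ℕ,
      y ∈ {y : ℕ → Set.Iic M | timeL a b (walk s fun k => (y k : ℝ)) 1 = n} := by
    filter_upwards [hosc x s] with y hy
    obtain ⟨n, hn⟩ := ENat.ne_top_iff_exists.1 (hy.timeL_ne_top 1)
    exact ⟨n, hn.symm⟩
  -- Splitting by the value of the first upcrossing time reduces the strong Markov property to the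
  -- one at fixed times.
  rw [lintegral_eq_tsum_of_ae_partition (fun n => measurableSet_timeL_eq s n) hd hc,
    lintegral_eq_tsum_of_ae_partition (fun n => measurableSet_timeL_eq s n) hd hc]
  congr 1
  ext n
  set D := {y : ℕ → Set.Iic M | timeL a b (walk s fun k => (y k : ℝ)) 1 = n} with hDdef
  have hD : MeasurableSet D := measurableSet_timeL_eq s n
  have hF : MeasurableSet (D ∩ {y | crossingSeq a b s y 0 ∈ A}) :=
    hD.inter ((measurable_pi_apply 0).comp hU hA)
  -- The first factor is an event of the past of n; the second sees the past only through the
  -- position of the walk at n.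
  let G : (ℕ → Set.Iic M) → (ℕ → Set.Iic M) → ℝ≥0∞ := fun p z =>
    (D ∩ {y | crossingSeq a b s y 0 ∈ A}).indicator 1 p *
      B.indicator 1 (crossingSeq a b (walk s (fun k => (p k : ℝ)) n) z)
  have hcm : Measurable fun q : (ℕ → Set.Iic M) × (ℕ → Set.Iic M) =>
      crossingSeq a b (walk s (fun k => (q.1 k : ℝ)) n) q.2 :=
    measurable_crossingSeq_comp ((measurable_walk (f := fun x : Set.Iic M => (x : ℝ))
      measurable_subtype_coe s n).comp measurable_fst) measurable_snd a b
  have hG : Measurable (Function.uncurry G) :=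
    ((measurable_one.indicator hF).comp measurable_fst).mul
      ((measurable_one.indicator hB).comp hcm)
  have hmem : ∀ y, stopPath n y ∈ D ∩ {y | crossingSeq a b s y 0 ∈ A} ↔
      y ∈ D ∩ {y | crossingSeq a b s y 0 ∈ A} := by
    intro y
    constructor
    · rintro ⟨h1, h2⟩
      have h1' := timeL_stopPath.1 h1
      exact ⟨h1', by simpa [crossingSeq_stopPath h1'] using h2⟩
    · rintro ⟨h1, h2⟩
      exact ⟨timeL_stopPath.2 h1, by simpa [crossingSeq_stopPath h1] using h2⟩
  have hmem' : ∀ y, (D ∩ {y | crossingSeq a b s y 0 ∈ A}).indicator (1 : (ℕ → Set.Iic M) → ℝ≥0∞)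
      (stopPath n y) = (D ∩ {y | crossingSeq a b s y 0 ∈ A}).indicator 1 y := by
    intro y
    by_cases h : y ∈ D ∩ {y | crossingSeq a b s y 0 ∈ A}
    · rw [Set.indicator_of_mem h, Set.indicator_of_mem ((hmem y).2 h)]; rfl
    · rw [Set.indicator_of_notMem h, Set.indicator_of_notMem fun h' => h ((hmem y).1 h')]
  have key := lintegral_stop_shift P x n hG
  rw [← lintegral_indicator hD, ← lintegral_indicator hD]
  refine Eq.trans (lintegral_congr_ae ?_) (key.trans (lintegral_congr fun y => ?_))
  · filter_upwards [hosc x s] with y hy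
    simp only [G, walk_stopPath, hmem']
    by_cases h1 : y ∈ D
    · have h2 : shiftPath 1 (crossingSeq a b s y) =
          crossingSeq a b (walk s (fun k => (y k : ℝ)) n) (shiftPath n y) := by
        ext1 j
        have := crossing_shift hy h1 j
        simp only [shiftPath, crossingSeq, add_comm 1 j]
        exact this
      have h3 : crossingSeq a b s y ∈ (fun u : ℕ → ℝ × ℝ × ℝ × ℝ × ℕ =>
          (u 0, shiftPath 1 u)) ⁻¹' A ×ˢ B ↔ crossingSeq a b s y 0 ∈ A ∧
            crossingSeq a b (walk s (fun k => (y k : ℝ)) n) (shiftPath n y) ∈ B := by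
        rw [← h2]; rfl
      rw [Set.indicator_of_mem h1]
      by_cases h4 : crossingSeq a b s y 0 ∈ A <;>
        by_cases h5 : crossingSeq a b (walk s (fun k => (y k : ℝ)) n) (shiftPath n y) ∈ B <;>
          simp only [Set.indicator, h3, h4, h5, h1, Set.mem_inter_iff, Set.mem_ofPred_eq,
            and_true, and_false, if_true, if_false, Pi.one_apply, mul_one, mul_zero]
    · simp [h1]
  · simp only [G, walk_stopPath, hmem']
    have hBm' : Measurable fun z : ℕ → Set.Iic M => B.indicator
        (1 : (ℕ → ℝ × ℝ × ℝ × ℝ × ℕ) → ℝ≥0∞)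
        (crossingSeq a b (walk s (fun k => (y k : ℝ)) n) z) :=
      (measurable_one.indicator hB).comp (measurable_crossingSeq a b _)
    rw [lintegral_const_mul _ hBm']
    by_cases h1 : y ∈ D
    · rw [← lintegral_map (f := B.indicator 1) (measurable_one.indicator hB)
          (measurable_crossingSeq a b _), lintegral_indicator_one hB]
      have h2 := crossingKernel_apply P a b (y n, walk s (fun k => (y k : ℝ)) n)
      simp only at h2
      rw [← h2]
      simp only [Set.indicator, h1, Set.mem_inter_iff, Set.mem_preimage,
        true_and, if_true, Set.mem_ofPred_eq, restart_crossingSeq h1]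
      by_cases h3 : crossingSeq a b s y 0 ∈ A <;> simp [h1, h3]
    · simp [h1]

end Crossing

/-! ### Small steps with a density bounded below, and oscillation -/

section SmallSteps

variable {M : ℝ} {P : Kernel (Set.Iic M) (Set.Iic M)} {C : ℝ≥0∞} {h : ℝ}

/-- Every transition law dominates `C` times Lebesgue measure on `[-h, h]`. -/
def SmallSteps (P : Kernel (Set.Iic M) (Set.Iic M)) (C : ℝ≥0∞) (h : ℝ) : Prop :=
  ∀ x, C • (volume.restrict (Set.Icc (-h) h)).map (toIic M) ≤ P x

/-- Shrinking h to at most M keeps [-h, h] inside the state space, so that `toIic` is the identity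
there. -/
lemma Minorized.exists_smallSteps (hM : 0 < M) (hP : Minorized P) :
    ∃ C h, C ≠ 0 ∧ C ≠ ∞ ∧ 0 < h ∧ h ≤ M ∧ SmallSteps P C h := by
  obtain ⟨α, h₀, hα, hh₀, hmin⟩ := hP
  refine ⟨ENNReal.ofReal α * ENNReal.ofReal (1 / (2 * h₀)), min h₀ M, ?_, ?_,
    lt_min hh₀ hM, min_le_right _ _, fun x => Measure.le_iff.2 fun A hA => ?_⟩
  · simp [hα, hh₀]
  · exact ENNReal.mul_ne_top ENNReal.ofReal_ne_top ENNReal.ofReal_ne_top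
  · refine le_trans ?_ (hmin x A hA)
    rw [Measure.smul_apply, smul_eq_mul, mul_assoc, normLeb,
      Measure.map_apply measurable_toIic hA, Measure.restrict_apply (measurable_toIic hA)]
    gcongr ENNReal.ofReal α * (_ * volume ?_)
    rintro v ⟨hv, hv1, hv2⟩
    have hvM : v ≤ M := hv2.trans (min_le_right _ _)
    refine ⟨⟨?_, hv2.trans (min_le_left _ _)⟩, ⟨toIic M v, hv, coe_toIic hvM⟩⟩
    exact (neg_le_neg (min_le_left _ _)).trans hv1

lemma SmallSteps.le_of_Icc (hP : SmallSteps P C h) {p q : ℝ} (hp : -h ≤ p) (hq : q ≤ h)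
    (x : Set.Iic M) : C • (volume.restrict (Set.Icc p q)).map (toIic M) ≤ P x := by
  refine le_trans ?_ (hP x)
  gcongr
  exact measurable_toIic

lemma smul_map_toIic_ne_zero (hC : C ≠ 0) {p q : ℝ} (hpq : p < q) :
    C • (volume.restrict (Set.Icc p q)).map (toIic M) ≠ 0 := by
  intro h0
  have := congrArg (fun m => m Set.univ) h0
  simp [Measure.map_apply measurable_toIic MeasurableSet.univ, hC, not_le.2 hpq] at this

lemma ae_smul_map_toIic {p q : ℝ} {R : Set.Iic M → Prop} (hR : MeasurableSet {x | R x})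
    (h : ∀ v ∈ Set.Icc p q, R (toIic M v)) :
    ∀ᵐ x ∂(C • (volume.restrict (Set.Icc p q)).map (toIic M)), R x := by
  refine Measure.ae_smul_measure ?_ C
  rw [ae_map_iff measurable_toIic.aemeasurable hR]
  filter_upwards [ae_restrict_mem measurableSet_Icc] with v hv using h v hv

variable [IsMarkovKernel P]

/-- For y ≤ M one has |y| ≤ 2 * M - y, and y has mean zero: the upper bound on the states controls
both tails. -/
lemma ZeroMean.lintegral_enorm_le (hM : 0 < M) (hmean : ZeroMean P) (x : Set.Iic M) :
    ∫⁻ y : Set.Iic M, ‖(y : ℝ)‖ₑ ∂(P x) ≤ ENNReal.ofReal (2 * M) := by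
  obtain ⟨hi, h0⟩ := hmean x
  rw [← ofReal_integral_norm_eq_lintegral_enorm hi]
  refine ENNReal.ofReal_le_ofReal ?_
  have h1 : ∫ y : Set.Iic M, ‖(y : ℝ)‖ ∂(P x) ≤ ∫ y : Set.Iic M, (2 * M - (y : ℝ)) ∂(P x) := by
    refine integral_mono hi.norm ((integrable_const _).sub hi) fun y => ?_
    have := y.2
    simp only [Set.mem_Iic] at this
    simp only [Real.norm_eq_abs]
    rcases abs_cases (y : ℝ) with h | h <;> linarith
  rw [integral_sub (integrable_const _) hi, h0] at h1
  simpa using h1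

/-- Almost surely the walk crosses any interval infinitely often in both directions. -/
theorem ae_oscillates (hM : 0 < M) (hmean : ZeroMean P) (hC : C ≠ 0) (hC' : C ≠ ∞) (hh : 0 < h)
    (hhM : h ≤ M) (hP : SmallSteps P C h) (a b : ℝ) (x : Set.Iic M) (s : ℝ) :
    ∀ᵐ y ∂(pathKernel P x), Oscillates a b (walk s fun k => (y k : ℝ)) := by
  have : Nonempty (Set.Iic M) := ⟨x⟩
  have hfin : ∀ p q : ℝ, IsFiniteMeasure (C • (volume.restrict (Set.Icc p q)).map (toIic M)) :=
    fun p q => Measure.smul_finite _ hC'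
  -- Recurrence is applied to the increments and to their negatives, with the minorizing measure cut
  -- down to [h/2, h] and [-h, -h/2], so that the increment at hand is at least δ = h/2.
  have hdown := ae_not_mem_boundedPaths (f := fun z : Set.Iic M => (z : ℝ)) P
    measurable_subtype_coe (hP.le_of_Icc (p := h / 2) (q := h) (by linarith) le_rfl)
    (half_pos hh) (smul_map_toIic_ne_zero hC (by linarith))
    (ae_smul_map_toIic (measurableSet_le measurable_const measurable_subtype_coe)
      fun v hv => by rw [coe_toIic (hv.2.trans hhM)]; exact hv.1)
    ENNReal.ofReal_ne_top (hmean.lintegral_enorm_le hM) (fun z => (hmean z).2) x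
  have hup := ae_not_mem_boundedPaths (f := fun z : Set.Iic M => -(z : ℝ)) P
    measurable_subtype_coe.neg
    (hP.le_of_Icc (p := -h) (q := -(h / 2)) le_rfl (by linarith))
    (half_pos hh) (smul_map_toIic_ne_zero hC (by linarith))
    (ae_smul_map_toIic (measurableSet_le measurable_const measurable_subtype_coe.neg)
      fun v hv => by rw [coe_toIic (by linarith [hv.2])]; linarith [hv.2])
    ENNReal.ofReal_ne_top (by simpa only [enorm_neg] using hmean.lintegral_enorm_le hM)
    (fun z => by rw [integral_neg, (hmean z).2, neg_zero]) x
  filter_upwards [hdown, hup] with y hy1 hy2 m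
  refine ⟨exists_walk_lt_of_not_mem hy1 s a m, ?_⟩
  obtain ⟨k, hk, hlt⟩ := exists_walk_lt_of_not_mem hy2 (-s) (-b) m
  refine ⟨k, hk, ?_⟩
  have : walk (-s) (fun j => -(y j : ℝ)) k = -walk s (fun j => (y j : ℝ)) k := by
    simp only [walk, Finset.sum_neg_distrib]; ring
  linarith

/-- The building block of the minorization. After the shift the first increment is `y 0`, which is
why the sets Z used below speak of a walk started at s + y 0. -/
lemma SmallSteps.one_step (hP : SmallSteps P C h) {Z Z' : Set (ℕ → Set.Iic M)}
    (hZ : MeasurableSet Z) (hsub : ∀ y, shiftPath 1 y ∈ Z → y ∈ Z') {p q : ℝ} (hp : -h ≤ p)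
    (hq : q ≤ h) {F : ℝ → ℝ≥0∞} (hF : ∀ v ∈ Set.Icc p q, F v ≤ pathKernel P (toIic M v) Z)
    (x : Set.Iic M) : C * ∫⁻ v in Set.Icc p q, F v ≤ pathKernel P x Z' := by
  have hm := (pathKernel P).measurable_coe hZ
  calc C * ∫⁻ v in Set.Icc p q, F v
      ≤ C * ∫⁻ v in Set.Icc p q, pathKernel P (toIic M v) Z := by
        gcongr C * ?_
        exact setLIntegral_mono' measurableSet_Icc hF
    _ = ∫⁻ z, pathKernel P z Z ∂(C • (volume.restrict (Set.Icc p q)).map (toIic M)) := by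
        rw [lintegral_smul_measure, lintegral_map hm measurable_toIic, smul_eq_mul]
    _ ≤ ∫⁻ z, pathKernel P z Z ∂(P x) := lintegral_mono' (hP.le_of_Icc hp hq x) le_rfl
    _ = pathKernel P x (shiftPath 1 ⁻¹' Z) := by
        rw [← Measure.bind_apply hZ (by fun_prop), ← pathKernel_map_shift_one,
          Measure.map_apply (by fun_prop) hZ]
    _ ≤ pathKernel P x Z' := measure_mono hsub

end SmallSteps

/-! ### A common component of the laws at upcrossings -/

section Minorization

variable {M : ℝ} {a b : ℝ} {A : Set (Set.Iic M × ℝ)}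

/-- The first passage of the walk above `b` happens in `A`. -/
def upHit (b : ℝ) (A : Set (Set.Iic M × ℝ)) (s : ℝ) : Set (ℕ → Set.Iic M) :=
  {y | ∃ l : ℕ, firstAfter (walk s fun k => (y k : ℝ)) (Set.Ioi b) 0 = l ∧
    (y l, walk s (fun k => (y k : ℝ)) l) ∈ A}

/-- The first upcrossing of the walk happens in `A`. -/
def crossHit (a b : ℝ) (A : Set (Set.Iic M × ℝ)) (s : ℝ) : Set (ℕ → Set.Iic M) :=
  {y | ∃ l : ℕ, timeL a b (walk s fun k => (y k : ℝ)) 1 = l ∧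
    (y l, walk s (fun k => (y k : ℝ)) l) ∈ A}

lemma measurable_add_zero_coe (s : ℝ) :
    Measurable fun y : ℕ → Set.Iic M => s + (y 0 : ℝ) := by
  fun_prop

lemma measurable_walk_add_zero (s : ℝ) (k : ℕ) :
    Measurable fun y : ℕ → Set.Iic M => walk (s + (y 0 : ℝ)) (fun k => (y k : ℝ)) k := by
  unfold walk
  fun_prop

lemma measurableSet_upHit_add (hA : MeasurableSet A) (s : ℝ) :
    MeasurableSet {y : ℕ → Set.Iic M | y ∈ upHit b A (s + (y 0 : ℝ))} := by
  have h1 : Measurable fun y : ℕ → Set.Iic M =>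
      firstAfter (walk (s + (y 0 : ℝ)) fun k => (y k : ℝ)) (Set.Ioi b) 0 :=
    measurable_firstAfter (measurable_walk_add_zero s) measurableSet_Ioi measurable_const
  have : {y : ℕ → Set.Iic M | y ∈ upHit b A (s + (y 0 : ℝ))} = ⋃ l : ℕ,
      {y | firstAfter (walk (s + (y 0 : ℝ)) fun k => (y k : ℝ)) (Set.Ioi b) 0 = l} ∩
        {y | (y l, walk (s + (y 0 : ℝ)) (fun k => (y k : ℝ)) l) ∈ A} := by
    ext y; simp [upHit]
  rw [this]
  exact MeasurableSet.iUnion fun l =>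
    (h1 (MeasurableSet.of_discrete (s := {(l : ℕ∞)}))).inter
      (((measurable_pi_apply l).prodMk (measurable_walk_add_zero s l)) hA)

lemma measurableSet_crossHit_add (hA : MeasurableSet A) (s : ℝ) :
    MeasurableSet {y : ℕ → Set.Iic M | y ∈ crossHit a b A (s + (y 0 : ℝ))} := by
  have h1 : Measurable fun y : ℕ → Set.Iic M =>
      timeL a b (walk (s + (y 0 : ℝ)) fun k => (y k : ℝ)) 1 :=
    measurable_timeL (measurable_walk_add_zero s) a b 1
  have : {y : ℕ → Set.Iic M | y ∈ crossHit a b A (s + (y 0 : ℝ))} = ⋃ l : ℕ,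
      {y | timeL a b (walk (s + (y 0 : ℝ)) fun k => (y k : ℝ)) 1 = l} ∩
        {y | (y l, walk (s + (y 0 : ℝ)) (fun k => (y k : ℝ)) l) ∈ A} := by
    ext y; simp [crossHit]
  rw [this]
  exact MeasurableSet.iUnion fun l =>
    (h1 (MeasurableSet.of_discrete (s := {(l : ℕ∞)}))).inter
      (((measurable_pi_apply l).prodMk (measurable_walk_add_zero s l)) hA)

lemma walk_one_add (s : ℝ) (y : ℕ → Set.Iic M) (l : ℕ) :
    walk s (fun k => (y k : ℝ)) (1 + l) =
      walk (s + (shiftPath 1 y 0 : Set.Iic M)) (fun k => (shiftPath 1 y k : Set.Iic M)) l := by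
  rw [walk_add, walk_succ, walk_zero]
  rfl

lemma firstAfter_one (s : ℝ) (y : ℕ → Set.Iic M) (B : Set ℝ) :
    firstAfter (walk s fun k => (y k : ℝ)) B 1 =
      1 + firstAfter (walk (s + (shiftPath 1 y 0 : Set.Iic M))
        fun k => (shiftPath 1 y k : Set.Iic M)) B 0 := by
  have := firstAfter_add (walk s fun k => (y k : ℝ)) B 1 0
  simp only [Nat.cast_one, add_zero] at this
  rw [this]
  simp_rw [walk_one_add]

lemma firstAfter_zero_of_notMem {s : ℕ → ℝ} {B : Set ℝ} (h : s 1 ∉ B) :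
    firstAfter s B 0 = firstAfter s B 1 := by
  have key : ∀ j : ℕ, s j ∈ B → ((0 : ℕ∞) < j ↔ (1 : ℕ∞) < j) := by
    intro j hj
    have h1 : j ≠ 1 := fun h1 => h (h1 ▸ hj)
    norm_cast
    omega
  unfold firstAfter
  congr 2
  ext j
  simp only [Set.mem_ofPred_eq]
  exact and_congr_left fun hj => key j hj

lemma walk_one (s : ℝ) (y : ℕ → Set.Iic M) :
    walk s (fun k => (y k : ℝ)) 1 = s + (shiftPath 1 y 0 : Set.Iic M) := by
  rw [walk_succ, walk_zero]; rfl

lemma mem_upHit_of_lt {s : ℝ} {y : ℕ → Set.Iic M} (h : b < s + (shiftPath 1 y 0 : Set.Iic M))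
    (hA : (shiftPath 1 y 0, s + ((shiftPath 1 y 0 : Set.Iic M) : ℝ)) ∈ A) : y ∈ upHit b A s := by
  refine ⟨1, ?_, ?_⟩
  · rw [firstAfter_eq_coe_iff]
    refine ⟨by simp, ?_, fun j hj hj' => ?_⟩
    · rw [walk_one]; exact h
    · have : 0 < j := by exact_mod_cast hj'
      omega
  · rw [walk_one]; exact hA

lemma mem_upHit_of_le {s : ℝ} {y : ℕ → Set.Iic M} (h : s + (shiftPath 1 y 0 : Set.Iic M) ≤ b)
    (hA : shiftPath 1 y ∈ upHit b A (s + (shiftPath 1 y 0 : Set.Iic M))) : y ∈ upHit b A s := by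
  obtain ⟨l, hl, hlA⟩ := hA
  refine ⟨1 + l, ?_, ?_⟩
  · rw [firstAfter_zero_of_notMem (by rw [walk_one]; exact not_lt.2 h), firstAfter_one, hl]
    push_cast; rfl
  · rw [walk_one_add]; exact hlA

lemma mem_crossHit_of_lt {s : ℝ} {y : ℕ → Set.Iic M} (h : s + (shiftPath 1 y 0 : Set.Iic M) < a)
    (hA : shiftPath 1 y ∈ upHit b A (s + (shiftPath 1 y 0 : Set.Iic M))) :
    y ∈ crossHit a b A s := by
  obtain ⟨l, hl, hlA⟩ := hA
  refine ⟨1 + l, ?_, ?_⟩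
  · have hT : firstAfter (walk s fun k => (y k : ℝ)) (Set.Iio a) 0 = (1 : ℕ) := by
      rw [firstAfter_eq_coe_iff]
      refine ⟨by simp, ?_, fun j hj hj' => ?_⟩
      · rw [walk_one]; exact h
      · have : 0 < j := by exact_mod_cast hj'
        omega
    change firstAfter _ _ (firstAfter _ _ 0) = _
    rw [hT, Nat.cast_one, firstAfter_one, hl]
    push_cast; rfl
  · rw [walk_one_add]; exact hlA

lemma mem_crossHit_of_le {s : ℝ} {y : ℕ → Set.Iic M} (h : a ≤ s + (shiftPath 1 y 0 : Set.Iic M))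
    (hA : shiftPath 1 y ∈ crossHit a b A (s + (shiftPath 1 y 0 : Set.Iic M))) :
    y ∈ crossHit a b A s := by
  obtain ⟨l, hl, hlA⟩ := hA
  refine ⟨1 + l, ?_, ?_⟩
  · change firstAfter _ _ (firstAfter _ _ 0) = _ at hl
    change firstAfter _ _ (firstAfter _ _ 0) = _
    rw [firstAfter_zero_of_notMem (by rw [walk_one]; exact not_lt.2 h), firstAfter_one]
    have := firstAfter_add (walk s fun k => (y k : ℝ)) (Set.Ioi b) 1
      (firstAfter (walk (s + (shiftPath 1 y 0 : Set.Iic M))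
        fun k => (shiftPath 1 y k : Set.Iic M)) (Set.Iio a) 0)
    simp only [Nat.cast_one] at this
    rw [this]
    simp_rw [walk_one_add]
    rw [hl]
    push_cast; rfl
  · rw [walk_one_add]; exact hlA

/-- The law of the state of chain and walk after two independent small steps across `b`. -/
noncomputable def landingLaw (M b h : ℝ) : Measure (Set.Iic M × ℝ) :=
  ((volume.restrict (Set.Icc (h / 2) h)).prod (volume.restrict (Set.Icc (b - h / 4) b))).map
    fun p => (toIic M p.1, p.2 + p.1)

lemma measurable_landing :
    Measurable fun p : ℝ × ℝ => ((toIic M p.1, p.2 + p.1) : Set.Iic M × ℝ) :=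
  (measurable_toIic.comp measurable_fst).prodMk (by fun_prop)

instance (M b h : ℝ) : IsFiniteMeasure (landingLaw M b h) := by
  unfold landingLaw; infer_instance

lemma landingLaw_apply (hA : MeasurableSet A) (b h : ℝ) :
    landingLaw M b h A = ∫⁻ v in Set.Icc (b - h / 4) b, ∫⁻ u in Set.Icc (h / 2) h,
      A.indicator 1 (toIic M u, v + u) := by
  rw [landingLaw, ← lintegral_indicator_one hA,
    lintegral_map (measurable_one.indicator hA) measurable_landing,
    lintegral_prod_symm' (fun p : ℝ × ℝ => A.indicator 1 (toIic M p.1, p.2 + p.1))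
      ((measurable_one.indicator hA).comp measurable_landing)]

variable {P : Kernel (Set.Iic M) (Set.Iic M)} [IsMarkovKernel P] {C : ℝ≥0∞} {h : ℝ}

lemma pathKernel_le_of_imp {x : Set.Iic M} {Z Z' : Set (ℕ → Set.Iic M)}
    (hZ : ∀ y, y 0 = x → y ∈ Z → y ∈ Z') : pathKernel P x Z ≤ pathKernel P x Z' := by
  refine measure_mono_ae ?_
  filter_upwards [ae_pathKernel_zero P x] with y hy hyZ using hZ y hy hyZ

/-- From b - h/4 or higher, a step u ≥ h/2 lands above b at once. -/
lemma SmallSteps.upHit_near (hP : SmallSteps P C h) (hh : 0 < h) (hhM : h ≤ M)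
    (hA : MeasurableSet A) (x : Set.Iic M) {s : ℝ} (hs : b - h / 4 ≤ s) :
    C * ∫⁻ u in Set.Icc (h / 2) h, A.indicator 1 (toIic M u, s + u) ≤
      pathKernel P x (upHit b A s) := by
  have hZ : MeasurableSet {y : ℕ → Set.Iic M | (y 0, s + (y 0 : ℝ)) ∈ A ∧ b < s + (y 0 : ℝ)} := by
    refine MeasurableSet.inter ?_ (measurableSet_lt measurable_const (measurable_add_zero_coe s))
    exact (by fun_prop : Measurable fun y : ℕ → Set.Iic M => (y 0, s + (y 0 : ℝ))) hA
  refine hP.one_step hZ (fun y hy => mem_upHit_of_lt hy.2 hy.1) (by linarith) le_rfl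
    (fun u hu => ?_) x
  by_cases hmem : (toIic M u, s + u) ∈ A
  · rw [Set.indicator_of_mem hmem, Pi.one_apply]
    have h1 : pathKernel P (toIic M u) Set.univ = 1 := measure_univ
    rw [← h1]
    refine pathKernel_le_of_imp fun y hy _ => ?_
    simp only [Set.mem_ofPred_eq, hy, coe_toIic (hu.2.trans hhM)]
    exact ⟨hmem, by linarith [hu.1]⟩
  · rw [Set.indicator_of_notMem hmem]; exact zero_le

/-- The first step places the walk in [b - h/4, b] with a density at least C, by translation
invariance of Lebesgue measure whatever s is; the second crosses b. Hence the lower bound forgets s.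
-/
lemma SmallSteps.upHit_of_mem_Icc (hP : SmallSteps P C h) (hh : 0 < h) (hhM : h ≤ M)
    (hA : MeasurableSet A) (x : Set.Iic M) {s : ℝ} (hs : b - h ≤ s) (hs' : s ≤ b) :
    C * C * landingLaw M b h A ≤ pathKernel P x (upHit b A s) := by
  set J := Set.Icc (b - h / 4) b with hJ
  set g : ℝ → ℝ≥0∞ := fun v => ∫⁻ u in Set.Icc (h / 2) h, A.indicator 1 (toIic M u, v + u)
    with hg
  have hZ : MeasurableSet {y : ℕ → Set.Iic M | s + (y 0 : ℝ) ≤ b ∧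
      y ∈ upHit b A (s + (y 0 : ℝ))} :=
    MeasurableSet.inter (measurableSet_le (measurable_add_zero_coe s) measurable_const)
      (measurableSet_upHit_add hA s)
  have hgm : Measurable g := by
    have : Measurable fun p : ℝ × ℝ => A.indicator (1 : Set.Iic M × ℝ → ℝ≥0∞)
        (toIic M p.2, p.1 + p.2) :=
      (measurable_one.indicator hA).comp
        ((measurable_toIic.comp measurable_snd).prodMk (by fun_prop))
    exact this.lintegral_prod_right'
  have key := hP.one_step hZ (fun y hy => mem_upHit_of_le hy.1 hy.2) (p := -h) (q := h) le_rfl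
    le_rfl (F := fun v => J.indicator (fun v => C * g v) (s + v)) (fun v hv => by
      by_cases hmem : s + v ∈ J
      · rw [Set.indicator_of_mem hmem]
        refine (hP.upHit_near hh hhM hA (toIic M v) hmem.1).trans
          (pathKernel_le_of_imp fun y hy hyZ => ?_)
        simp only [Set.mem_ofPred_eq, hy, coe_toIic (hv.2.trans hhM)]
        exact ⟨hmem.2, hyZ⟩
      · rw [Set.indicator_of_notMem hmem]; exact zero_le) x
  refine le_trans (le_of_eq ?_) key
  -- The cutoff to [-h, h] is inactive: s ∈ [b - h, b] and s + v ∈ [b - h/4, b] force v into it.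
  have h1 : ∫⁻ v in Set.Icc (-h) h, J.indicator (fun v => C * g v) (s + v) =
      ∫⁻ v, J.indicator (fun v => C * g v) (s + v) := by
    rw [← lintegral_indicator measurableSet_Icc]
    congr 1
    ext v
    by_cases hv : v ∈ Set.Icc (-h) h
    · rw [Set.indicator_of_mem hv]
    · rw [Set.indicator_of_notMem hv, Set.indicator_of_notMem]
      rintro ⟨h2, h3⟩
      exact hv ⟨by linarith, by linarith⟩
  rw [h1, lintegral_add_left_eq_self (fun v => J.indicator (fun v => C * g v) v) s,
    lintegral_indicator measurableSet_Icc, lintegral_const_mul _ hgm, landingLaw_apply hA,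
    mul_assoc]

/-- A lower bound which survives a range of small steps survives a single step, up to a factor. -/
lemma SmallSteps.const_step (hP : SmallSteps P C h) {Z Z' : Set (ℕ → Set.Iic M)}
    (hZ : MeasurableSet Z) (hsub : ∀ y, shiftPath 1 y ∈ Z → y ∈ Z') {p q : ℝ} (hp : -h ≤ p)
    (hq : q ≤ h) {K : ℝ≥0∞} (hF : ∀ v ∈ Set.Icc p q, K ≤ pathKernel P (toIic M v) Z)
    (x : Set.Iic M) : C * ENNReal.ofReal (q - p) * K ≤ pathKernel P x Z' := by
  have := hP.one_step hZ hsub hp hq (F := fun _ => K) hF x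
  rw [setLIntegral_const, Real.volume_Icc] at this
  rwa [mul_assoc, mul_comm (ENNReal.ofReal _)]

/-- Climbing by steps in [h/2, h]: from a start below b - h such a step cannot exceed b, so the
first passage is still to come, and boundedly many steps reach [b - h, b]. -/
lemma SmallSteps.exists_upHit (hP : SmallSteps P C h) (hC : C ≠ 0) (hh : 0 < h) (hhM : h ≤ M)
    (b r : ℝ) : ∃ ε : ℝ≥0∞, ε ≠ 0 ∧ ∀ (A : Set (Set.Iic M × ℝ)), MeasurableSet A →
      ∀ (x : Set.Iic M) (s : ℝ), r ≤ s → s ≤ b →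
        ε * landingLaw M b h A ≤ pathKernel P x (upHit b A s) := by
  have key : ∀ k : ℕ, ∃ ε : ℝ≥0∞, ε ≠ 0 ∧ ∀ (A : Set (Set.Iic M × ℝ)), MeasurableSet A →
      ∀ (x : Set.Iic M) (s : ℝ), b - h - k * (h / 2) ≤ s → s ≤ b →
        ε * landingLaw M b h A ≤ pathKernel P x (upHit b A s) := by
    intro k
    induction k with
    | zero =>
      exact ⟨C * C, mul_ne_zero hC hC, fun A hA x s hs hs' =>
        hP.upHit_of_mem_Icc hh hhM hA x (by simpa using hs) hs'⟩
    | succ k ih =>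
      obtain ⟨ε, hε, hstep⟩ := ih
      refine ⟨min ε (C * ENNReal.ofReal (h - h / 2) * ε), ?_, fun A hA x s hs hs' => ?_⟩
      · refine (lt_min (pos_iff_ne_zero.2 hε) (pos_iff_ne_zero.2 ?_)).ne'
        refine mul_ne_zero (mul_ne_zero hC ?_) hε
        rw [ne_eq, ENNReal.ofReal_eq_zero]
        linarith
      · push_cast at hs
        have hk : (0 : ℝ) ≤ k * (h / 2) := by positivity
        rcases le_or_gt (b - h - k * (h / 2)) s with h1 | h1
        · exact (mul_le_mul_left (min_le_left _ _) _).trans (hstep A hA x s h1 hs')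
        · have hZ : MeasurableSet {y : ℕ → Set.Iic M | s + (y 0 : ℝ) ≤ b ∧
              y ∈ upHit b A (s + (y 0 : ℝ))} :=
            MeasurableSet.inter (measurableSet_le (measurable_add_zero_coe s) measurable_const)
              (measurableSet_upHit_add hA s)
          refine (mul_le_mul_left (min_le_right _ _) _).trans ?_
          rw [mul_assoc]
          refine hP.const_step hZ (fun y hy => mem_upHit_of_le hy.1 hy.2) (by linarith) le_rfl
            (fun v hv => ?_) x
          refine (hstep A hA (toIic M v) (s + v) (by linarith [hv.1]) (by linarith [hv.2])).trans
            (pathKernel_le_of_imp fun y hy hyZ => ?_)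
          simp only [Set.mem_ofPred_eq, hy, coe_toIic (hv.2.trans hhM)]
          exact ⟨by linarith [hv.2], hyZ⟩
  obtain ⟨k, hk⟩ := exists_nat_ge ((b - h - r) / (h / 2))
  rw [div_le_iff₀ (by linarith)] at hk
  obtain ⟨ε, hε, hstep⟩ := key k
  exact ⟨ε, hε, fun A hA x s hs hs' => hstep A hA x s (by linarith) hs'⟩

/-- Descending by steps in [-h, -h/2] reaches a point below a after boundedly many steps; from there
the climb of `exists_upHit` takes over. -/
lemma SmallSteps.exists_crossHit (hP : SmallSteps P C h) (hC : C ≠ 0) (hh : 0 < h) (hhM : h ≤ M)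
    (hab : a ≤ b) (r : ℝ) :
    ∃ ε : ℝ≥0∞, ε ≠ 0 ∧ ∀ (A : Set (Set.Iic M × ℝ)), MeasurableSet A →
      ∀ (x : Set.Iic M) (s : ℝ), a ≤ s → s ≤ r →
        ε * landingLaw M b h A ≤ pathKernel P x (crossHit a b A s) := by
  -- The step that first passes below a has size at most h, so the climb starts no lower than a - h.
  obtain ⟨ε₀, hε₀, hup⟩ := hP.exists_upHit hC hh hhM b (a - h)
  have key : ∀ k : ℕ, ∃ ε : ℝ≥0∞, ε ≠ 0 ∧ ∀ (A : Set (Set.Iic M × ℝ)), MeasurableSet A →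
      ∀ (x : Set.Iic M) (s : ℝ), a ≤ s → s < a + k * (h / 2) →
        ε * landingLaw M b h A ≤ pathKernel P x (crossHit a b A s) := by
    intro k
    induction k with
    | zero =>
      refine ⟨1, one_ne_zero, fun A hA x s hs hs' => ?_⟩
      simp only [Nat.cast_zero, zero_mul, add_zero] at hs'
      linarith
    | succ k ih =>
      obtain ⟨ε, hε, hstep⟩ := ih
      refine ⟨C * ENNReal.ofReal (-(h / 2) - -h) * min ε ε₀, ?_, fun A hA x s hs hs' => ?_⟩
      · refine mul_ne_zero (mul_ne_zero hC ?_)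
          (lt_min (pos_iff_ne_zero.2 hε) (pos_iff_ne_zero.2 hε₀)).ne'
        rw [ne_eq, ENNReal.ofReal_eq_zero]
        linarith
      · push_cast at hs'
        have hZ₁ : MeasurableSet ({y : ℕ → Set.Iic M | s + (y 0 : ℝ) < a} ∩
            {y | y ∈ upHit b A (s + (y 0 : ℝ))}) :=
          (measurableSet_lt (measurable_add_zero_coe s) measurable_const).inter
            (measurableSet_upHit_add hA s)
        have hZ₂ : MeasurableSet ({y : ℕ → Set.Iic M | a ≤ s + (y 0 : ℝ)} ∩
            {y | y ∈ crossHit a b A (s + (y 0 : ℝ))}) :=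
          (measurableSet_le measurable_const (measurable_add_zero_coe s)).inter
            (measurableSet_crossHit_add hA s)
        rw [mul_assoc]
        refine hP.const_step (hZ₁.union hZ₂) (fun y hy => ?_) le_rfl (by linarith)
          (fun v hv => ?_) x
        · rcases hy with hy | hy
          · exact mem_crossHit_of_lt hy.1 hy.2
          · exact mem_crossHit_of_le hy.1 hy.2
        · have hvM : v ≤ M := by linarith [hv.2]
          rcases lt_or_ge (s + v) a with h1 | h1
          · refine (mul_le_mul_left (min_le_right _ _) _).trans
              ((hup A hA (toIic M v) (s + v) (by linarith [hv.1]) (by linarith)).trans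
              (pathKernel_le_of_imp fun y hy hyZ => Or.inl ?_))
            simp only [Set.mem_inter_iff, Set.mem_ofPred_eq, hy, coe_toIic hvM]
            exact ⟨h1, hyZ⟩
          · refine (mul_le_mul_left (min_le_left _ _) _).trans
              ((hstep A hA (toIic M v) (s + v) h1 (by linarith [hv.2])).trans
              (pathKernel_le_of_imp fun y hy hyZ => Or.inr ?_))
            simp only [Set.mem_inter_iff, Set.mem_ofPred_eq, hy, coe_toIic hvM]
            exact ⟨h1, hyZ⟩
  obtain ⟨k, hk⟩ := exists_nat_gt ((r - a) / (h / 2))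
  rw [div_lt_iff₀ (by linarith)] at hk
  obtain ⟨ε, hε, hstep⟩ := key k
  exact ⟨ε, hε, fun A hA x s hs hs' => hstep A hA x s hs (by linarith)⟩

lemma renewalKernel_crossingKernel_apply (w : Set.Iic M × ℝ) (hA : MeasurableSet A) :
    renewalKernel (crossingKernel P a b) (restart M) w A =
      pathKernel P w.1 {y | restart M (crossingSeq a b w.2 y 0) ∈ A} := by
  have hm : Measurable fun u : ℕ → ℝ × ℝ × ℝ × ℝ × ℕ => restart M (u 0) :=
    measurable_restart.comp (measurable_pi_apply 0)
  rw [renewalKernel, Kernel.map_apply _ hm, Measure.map_apply hm hA, crossingKernel_apply,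
    Measure.map_apply (measurable_crossingSeq a b w.2) (hm hA)]
  rfl

/-- From every state at an upcrossing, the state at the next one has a common component. -/
theorem SmallSteps.exists_minorization (hP : SmallSteps P C h) (hC : C ≠ 0) (hh : 0 < h)
    (hhM : h ≤ M) (hab : a ≤ b) (r : ℝ) :
    ∃ ε : ℝ≥0∞, ε ≠ 0 ∧ ε ≠ ∞ ∧ ∀ w : Set.Iic M × ℝ, a ≤ w.2 → w.2 ≤ r →
      ε • landingLaw M b h ≤ renewalKernel (crossingKernel P a b) (restart M) w := by
  obtain ⟨ε, hε, hcross⟩ := hP.exists_crossHit hC hh hhM hab r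
  -- The minimum with 1 only serves to make the constant finite.
  refine ⟨min ε 1, (lt_min (pos_iff_ne_zero.2 hε) one_pos).ne',
    ne_top_of_le_ne_top ENNReal.one_ne_top (min_le_right _ _),
    fun w hw hw' => Measure.le_iff.2 fun A hA => ?_⟩
  rw [renewalKernel_crossingKernel_apply w hA, Measure.smul_apply, smul_eq_mul]
  refine (mul_le_mul_left (min_le_left _ _) _).trans ((hcross A hA w.1 w.2 hw hw').trans ?_)
  refine measure_mono ?_
  rintro y ⟨l, hl, hlA⟩
  change restart M (crossingSeq a b w.2 y 0) ∈ A
  rwa [restart_crossingSeq hl]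

lemma landingLaw_ne_zero (M b : ℝ) (hh : 0 < h) : landingLaw M b h ≠ 0 := by
  intro h0
  have h1 := congrArg (fun m => m Set.univ) h0
  rw [landingLaw, Measure.map_apply measurable_landing MeasurableSet.univ, Set.preimage_univ,
    ← Set.univ_prod_univ, Measure.prod_prod] at h1
  simp only [Measure.restrict_apply MeasurableSet.univ,
    Set.univ_inter, Real.volume_Icc, Measure.coe_zero, Pi.zero_apply, mul_eq_zero,
    ENNReal.ofReal_eq_zero] at h1
  rcases h1 with h1 | h1 <;> linarith

end Minorization

/-! ### Exact hits of the upper threshold are negligible -/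

section Level

variable {M : ℝ} (P : Kernel (Set.Iic M) (Set.Iic M)) [IsMarkovKernel P] (a b : ℝ)

/-- The starts and paths for which the walk hits the level `b` exactly. -/
def hitsLevel (M b : ℝ) : Set (ℝ × (ℕ → Set.Iic M)) :=
  {p | ∃ k, walk p.1 (fun j => (p.2 j : ℝ)) k = b}

/-- The states from which the walk hits the level `b` exactly with positive probability. -/
def levelStates : Set (Set.Iic M × ℝ) :=
  {w | pathKernel P w.1 (Prod.mk w.2 ⁻¹' hitsLevel M b) ≠ 0}

lemma measurableSet_hitsLevel : MeasurableSet (hitsLevel M b) := by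
  unfold hitsLevel
  simp only [Set.ofPred_exists]
  refine MeasurableSet.iUnion fun k => measurableSet_eq_fun ?_ measurable_const
  unfold walk
  fun_prop

lemma measurable_pathKernel_section {H : Set (ℝ × (ℕ → Set.Iic M))} (hH : MeasurableSet H) :
    Measurable fun w : Set.Iic M × ℝ => pathKernel P w.1 (Prod.mk w.2 ⁻¹' H) := by
  have hm : Measurable fun q : (Set.Iic M × ℝ) × (ℕ → Set.Iic M) => (q.1.2, q.2) := by fun_prop
  have h1 := Kernel.measurable_kernel_prodMk_left (κ := (pathKernel P).comap
    (Prod.fst : Set.Iic M × ℝ → Set.Iic M) measurable_fst) (hm hH)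
  simp only [Kernel.comap_apply] at h1
  exact h1

lemma measurableSet_levelStates : MeasurableSet (levelStates P b) :=
  measurable_pathKernel_section P (measurableSet_hitsLevel b) (MeasurableSet.singleton 0).compl

/-- Fubini: a fixed path hits b exactly from only countably many starting positions s. -/
lemma volume_levelStates (x : Set.Iic M) : volume {s | (x, s) ∈ levelStates P b} = 0 := by
  have h0 : (volume.prod (pathKernel P x)) (hitsLevel M b) = 0 := by
    rw [Measure.prod_apply_symm (measurableSet_hitsLevel b)]
    refine lintegral_eq_zero_of_ae_eq_zero (Eventually.of_forall fun y => ?_)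
    refine Set.Countable.measure_zero ((Set.countable_range fun k =>
      b - walk 0 (fun j => (y j : ℝ)) k).mono ?_) _
    rintro s ⟨k, hk⟩
    refine ⟨k, ?_⟩
    simp only at hk ⊢
    rw [walk_start] at hk
    linarith
  have h1 := Measure.measure_ae_null_of_prod_null h0
  rw [EventuallyEq, ae_iff] at h1
  exact h1

/-- Given the last step u, the landing position is v + u with v having a Lebesgue density. -/
lemma landingLaw_levelStates (h : ℝ) : landingLaw M b h (levelStates P b) = 0 := by
  have hm := measurable_landing (M := M) (measurableSet_levelStates P b)
  rw [landingLaw, Measure.map_apply measurable_landing (measurableSet_levelStates P b),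
    Measure.measure_prod_null hm]
  refine Eventually.of_forall fun u => ?_
  have h1 : volume ((fun v => v + u) ⁻¹' {s | (toIic M u, s) ∈ levelStates P b}) = 0 := by
    rw [measure_preimage_add_right]
    exact volume_levelStates P b _
  exact le_antisymm ((Measure.restrict_apply_le _ _).trans h1.le) bot_le

variable {P a b}

/-- If a state visited at time n could hit b with positive probability, the Markov property at n
would give the original state a positive probability to hit b. -/
lemma ae_notMem_levelStates {w : Set.Iic M × ℝ} (hw : w ∉ levelStates P b) :
    ∀ᵐ y ∂(pathKernel P w.1), ∀ n, (y n, walk w.2 (fun j => (y j : ℝ)) n) ∉ levelStates P b := by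
  rw [ae_all_iff]
  intro n
  have hw0 : pathKernel P w.1 (Prod.mk w.2 ⁻¹' hitsLevel M b) = 0 := not_not.1 hw
  let S : (ℕ → Set.Iic M) → ℝ := fun p => walk w.2 (fun j => (p j : ℝ)) n
  have hS : Measurable S := measurable_walk measurable_subtype_coe w.2 n
  have hSstop : ∀ y, S (stopPath n y) = S y := fun y => walk_stopPath w.2 y n
  let G : (ℕ → Set.Iic M) → (ℕ → Set.Iic M) → ℝ≥0∞ := fun p z =>
    (hitsLevel M b).indicator 1 (S p, z)
  have hG : Measurable (Function.uncurry G) :=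
    (measurable_one.indicator (measurableSet_hitsLevel b)).comp
      ((hS.comp measurable_fst).prodMk measurable_snd)
  have key := lintegral_stop_shift P w.1 n hG
  have h0 : ∫⁻ y, G (stopPath n y) (shiftPath n y) ∂(pathKernel P w.1) = 0 := by
    refine lintegral_eq_zero_of_ae_eq_zero ?_
    have hnot : ∀ᵐ y ∂(pathKernel P w.1), y ∉ Prod.mk w.2 ⁻¹' hitsLevel M b :=
      measure_eq_zero_iff_ae_notMem.1 hw0
    filter_upwards [hnot] with y hy
    refine Set.indicator_of_notMem ?_ _
    rw [hSstop]
    rintro ⟨k, hk⟩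
    refine hy ⟨n + k, ?_⟩
    rw [walk_add]
    exact hk
  have hint : ∀ y, ∫⁻ z, G (stopPath n y) z ∂(pathKernel P (y n)) =
      pathKernel P (y n) (Prod.mk (S y) ⁻¹' hitsLevel M b) := by
    intro y
    simp only [G, hSstop]
    exact lintegral_indicator_one (measurable_prodMk_left (measurableSet_hitsLevel b))
  rw [key, lintegral_congr hint] at h0
  have hmeas : Measurable fun y : ℕ → Set.Iic M =>
      pathKernel P (y n) (Prod.mk (S y) ⁻¹' hitsLevel M b) := by
    have hpair : Measurable fun y : ℕ → Set.Iic M => (y n, S y) :=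
      (measurable_pi_apply n).prodMk hS
    have h1 := (measurable_pathKernel_section P (measurableSet_hitsLevel b)).comp hpair
    simp only [Function.comp_def] at h1
    exact h1
  rw [lintegral_eq_zero_iff hmeas] at h0
  filter_upwards [h0] with y hy
  simp only [levelStates, Set.mem_ofPred_eq, not_not]
  exact hy

lemma renewalKernel_levelStates
    (hosc : ∀ x s, ∀ᵐ y ∂(pathKernel P x), Oscillates a b (walk s fun k => (y k : ℝ)))
    {w : Set.Iic M × ℝ} (hw : w ∉ levelStates P b) :
    renewalKernel (crossingKernel P a b) (restart M) w (levelStates P b) = 0 := by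
  rw [renewalKernel_crossingKernel_apply w (measurableSet_levelStates P b)]
  have : ∀ᵐ y ∂(pathKernel P w.1), restart M (crossingSeq a b w.2 y 0) ∉ levelStates P b := by
    filter_upwards [ae_notMem_levelStates hw, hosc w.1 w.2] with y hy1 hy2
    obtain ⟨n, hn⟩ := ENat.ne_top_iff_exists.1 (hy2.timeL_ne_top 1)
    rw [restart_crossingSeq hn.symm]
    exact hy1 n
  rw [ae_iff] at this
  simpa using this

end Level

/-! ### The stationary law is concentrated on the open state space -/

section Stationary

variable {M : ℝ} {P : Kernel (Set.Iic M) (Set.Iic M)} [IsMarkovKernel P] {a b : ℝ}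

lemma restart_mem_Ioc (hab : a ≤ b) {s : ℝ} {y : ℕ → Set.Iic M}
    (hosc : Oscillates a b (walk s fun k => (y k : ℝ))) :
    restart M (crossingSeq a b s y 0) ∈ (Set.univ ×ˢ Set.Ioc b (b + M) : Set (Set.Iic M × ℝ)) := by
  obtain ⟨l, hl⟩ := ENat.ne_top_iff_exists.1 (hosc.timeL_ne_top 1)
  obtain ⟨t, j, -, hlt, -, -, h1, h2, -⟩ := crossing_one_spec hl.symm hab
  rw [restart_crossingSeq hl.symm]
  refine ⟨trivial, h1, ?_⟩
  simp only [hlt, walk_succ]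
  exact add_le_add h2 (y (t + j + 1)).2

/-- Starting from s ≥ a makes the step at the downcrossing negative. Not being at b just before the
upcrossing makes the overshoot smaller than M. -/
lemma crossingSeq_mem_stateSpace (hab : a ≤ b) {s : ℝ} {y : ℕ → Set.Iic M} (hs : a ≤ s)
    (hosc : Oscillates a b (walk s fun k => (y k : ℝ)))
    (hlevel : ∀ k, walk s (fun j => (y j : ℝ)) k ≠ b) :
    crossingSeq a b s y 0 ∈ stateSpace M a b := by
  obtain ⟨l, hl⟩ := ENat.ne_top_iff_exists.1 (hosc.timeL_ne_top 1)
  obtain ⟨t, j, ht, hlt, hc, h0, h1, h2, h3⟩ := crossing_one_spec hl.symm hab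
  have h4 := h3 hs
  have h2' := lt_of_le_of_ne h2 (hlevel (t + j))
  obtain ⟨t, rfl⟩ := Nat.exists_eq_add_of_le' ht
  subst hlt
  have h5 := (y (t + 1 + j + 1)).2
  simp only [Set.mem_Iic] at h5
  have e1 := walk_succ s (fun k => (y k : ℝ)) t
  have e2 := walk_succ s (fun k => (y k : ℝ)) (t + 1 + j)
  simp only [Nat.add_sub_cancel] at h4
  change crossing a b s (fun k => (y k : ℝ)) 1 ∈ _
  rw [hc]
  refine ⟨?_, h0, ⟨?_, h5⟩, ⟨h1, ?_⟩, ?_⟩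
  · simp only [Set.mem_Iio]; linarith
  · simp only; linarith
  · simp only; linarith
  · simp only [Set.mem_ofPred_eq]; omega

lemma measurableSet_stateSpace (M a b : ℝ) : MeasurableSet (stateSpace M a b) :=
  measurableSet_Iio.prod (measurableSet_Iio.prod (measurableSet_Ioc.prod
    (measurableSet_Ioo.prod MeasurableSet.of_discrete)))

lemma map_crossingKernel_apply (w : Set.Iic M × ℝ) {A : Set (ℝ × ℝ × ℝ × ℝ × ℕ)}
    (hA : MeasurableSet A) :
    (crossingKernel P a b).map (fun u => u 0) w A =
      pathKernel P w.1 {y | crossingSeq a b w.2 y 0 ∈ A} := by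
  rw [Kernel.map_apply' _ (measurable_pi_apply 0) _ hA, crossingKernel_apply,
    Measure.map_apply (measurable_crossingSeq a b w.2) (measurable_pi_apply 0 hA)]
  rfl

lemma bind_crossingKernel_stateSpace
    (hosc : ∀ x s, ∀ᵐ y ∂(pathKernel P x), Oscillates a b (walk s fun k => (y k : ℝ)))
    (hab : a ≤ b) {π : Measure (Set.Iic M × ℝ)} [IsProbabilityMeasure π]
    (hπ : π (Set.univ ×ˢ Set.Ioc b (b + M))ᶜ = 0) (hlevel : π (levelStates P b) = 0) :
    (π.bind ((crossingKernel P a b).map fun u => u 0)) (stateSpace M a b) = 1 := by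
  have hR : IsMarkovKernel ((crossingKernel P a b).map fun u => u 0) :=
    Kernel.IsMarkovKernel.map _ (measurable_pi_apply 0)
  have hm := measurableSet_stateSpace M a b
  rw [Measure.bind_apply hm (Kernel.aemeasurable _)]
  have hae : ∀ᵐ w ∂π, (crossingKernel P a b).map (fun u => u 0) w (stateSpace M a b) = 1 := by
    filter_upwards [measure_eq_zero_iff_ae_notMem.1 hπ, measure_eq_zero_iff_ae_notMem.1 hlevel]
      with w hw hw'
    have hwb : b < w.2 := (not_not.1 hw).2.1
    have hw0 : pathKernel P w.1 (Prod.mk w.2 ⁻¹' hitsLevel M b) = 0 := not_not.1 hw'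
    rw [map_crossingKernel_apply w hm, ← measure_univ (μ := pathKernel P w.1)]
    refine measure_congr (eventuallyEq_univ.2 ?_)
    filter_upwards [hosc w.1 w.2, measure_eq_zero_iff_ae_notMem.1 hw0] with y hy hy'
    exact crossingSeq_mem_stateSpace hab (hab.trans hwb.le) hy fun k hk => hy' ⟨k, hk⟩
  rw [lintegral_congr_ae hae, lintegral_one, measure_univ]

end Stationary

/-! ### From fixed initial states to an arbitrary chain and independent start -/

section Transfer

variable {M : ℝ} {P : Kernel (Set.Iic M) (Set.Iic M)} [IsMarkovKernel P] {a b : ℝ}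

lemma prod_bind_pathKernel_apply (σ : Measure ℝ) [IsProbabilityMeasure σ]
    (ν : Measure (Set.Iic M)) [IsProbabilityMeasure ν] {H : Set (ℝ × (ℕ → Set.Iic M))}
    (hH : MeasurableSet H) :
    (σ.prod (ν.bind (pathKernel P))) H =
      ∫⁻ w, pathKernel P w.1 (Prod.mk w.2 ⁻¹' H) ∂(ν.prod σ) := by
  rw [Measure.prod_apply hH, lintegral_prod_symm' _ (measurable_pathKernel_section P hH)]
  refine lintegral_congr fun s => ?_
  rw [Measure.bind_apply (measurable_prodMk_left hH) (Kernel.aemeasurable _)]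

lemma ae_prod_bind_pathKernel (σ : Measure ℝ) [IsProbabilityMeasure σ]
    (ν : Measure (Set.Iic M)) [IsProbabilityMeasure ν] {H : Set (ℝ × (ℕ → Set.Iic M))}
    (hH : MeasurableSet H) (h : ∀ x s, ∀ᵐ y ∂(pathKernel P x), (s, y) ∈ H) :
    ∀ᵐ p ∂(σ.prod (ν.bind (pathKernel P))), p ∈ H := by
  rw [ae_iff]
  change (σ.prod (ν.bind (pathKernel P))) Hᶜ = 0
  rw [prod_bind_pathKernel_apply σ ν hH.compl]
  refine lintegral_eq_zero_of_ae_eq_zero (Eventually.of_forall fun w => ?_)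
  exact h w.1 w.2

/-- A bound on the laws of the crossing data given the initial state passes to the joint law. -/
lemma abs_measureReal_crossingSeq_sub_le (σ : Measure ℝ) [IsProbabilityMeasure σ]
    (ν : Measure (Set.Iic M)) [IsProbabilityMeasure ν] {B : Set (ℕ → ℝ × ℝ × ℝ × ℝ × ℕ)}
    (hB : MeasurableSet B) {c K : ℝ} (h : ∀ w, |(crossingKernel P a b w).real B - c| ≤ K) :
    |(σ.prod (ν.bind (pathKernel P))).real ((fun p => crossingSeq a b p.1 p.2) ⁻¹' B) - c| ≤ K := by
  have h1 : (σ.prod (ν.bind (pathKernel P))) ((fun p => crossingSeq a b p.1 p.2) ⁻¹' B) =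
      ∫⁻ w, crossingKernel P a b w B ∂(ν.prod σ) := by
    refine (prod_bind_pathKernel_apply σ ν (measurable_crossingSeq_uncurry a b hB)).trans ?_
    refine lintegral_congr fun w => ?_
    rw [crossingKernel_apply, Measure.map_apply (measurable_crossingSeq a b w.2) hB]
    rfl
  have hm := (crossingKernel P a b).measurable_coe hB
  have h2 : (σ.prod (ν.bind (pathKernel P))).real ((fun p => crossingSeq a b p.1 p.2) ⁻¹' B) =
      ∫ w, (crossingKernel P a b w).real B ∂(ν.prod σ) := by
    rw [measureReal_def, h1]
    exact (integral_toReal hm.aemeasurable (Eventually.of_forall fun w => measure_lt_top _ _)).symm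
  have hi : Integrable (fun w => (crossingKernel P a b w).real B) (ν.prod σ) := by
    refine Integrable.of_bound (C := 1) hm.ennreal_toReal.aestronglyMeasurable
      (Eventually.of_forall fun w => ?_)
    rw [Real.norm_of_nonneg measureReal_nonneg]
    exact measureReal_le_one
  have h3 : ∫ w, ((crossingKernel P a b w).real B - c) ∂(ν.prod σ) =
      ∫ w, (crossingKernel P a b w).real B ∂(ν.prod σ) - c := by
    rw [integral_sub hi (integrable_const c)]
    simp
  rw [h2, ← h3]
  have h4 := norm_integral_le_of_norm_le_const (μ := ν.prod σ)
    (f := fun w => (crossingKernel P a b w).real B - c) (Eventually.of_forall h)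
  simpa using h4

/-- The joint law of an independent start and a Markov chain. -/
lemma IsMarkovChain.map_prodMk {Ω : Type*} [MeasurableSpace Ω] {μ : Measure Ω}
    [IsProbabilityMeasure μ] {X : ℕ → Ω → Set.Iic M} {S₀ : Ω → ℝ} (hX : IsMarkovChain P X μ)
    (hS₀ : Measurable S₀) (hind : IndepFun S₀ (fun ω n => X n ω) μ) :
    μ.map (fun ω => (S₀ ω, fun n => X n ω)) =
      (μ.map S₀).prod ((μ.map (X 0)).bind (pathKernel P)) := by
  have hXm : Measurable fun ω n => X n ω := measurable_pi_iff.2 hX.1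
  rw [(indepFun_iff_map_prod_eq_prod_map_map hS₀.aemeasurable hXm.aemeasurable).1 hind]
  have hprob : IsProbabilityMeasure (μ.map fun ω n => X n ω) :=
    Measure.isProbabilityMeasure_map hXm.aemeasurable
  have h := (hX.markovLaw P).eq_bind P
  rw [Measure.map_map (measurable_pi_apply 0) hXm] at h
  rw [h]
  rfl

end Transfer

/-! ### The final constants and the main theorem -/

section Main

variable {M a b : ℝ}

lemma measurableSet_timeL_ne_top (n : ℕ) : MeasurableSet
    {p : ℝ × (ℕ → Set.Iic M) | timeL a b (walk p.1 fun k => (p.2 k : ℝ)) n ≠ ⊤} := by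
  have hm : Measurable fun p : ℝ × (ℕ → Set.Iic M) =>
      timeL a b (walk p.1 fun k => (p.2 k : ℝ)) n := by
    refine measurable_timeL (fun k => ?_) a b n
    unfold walk
    fun_prop
  exact hm (MeasurableSet.of_discrete (s := {(⊤ : ℕ∞)}ᶜ))

lemma timeT_succ_ne_top {s : ℕ → ℝ} {n : ℕ} (h : timeL a b s (n + 1) ≠ ⊤) :
    timeT a b s (n + 1) ≠ ⊤ := by
  intro h'
  refine h (firstAfter_eq_top_iff.2 fun k hk => ?_)
  change firstAfter s (Set.Iio a) (timeL a b s n) = ⊤ at h'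
  rw [h'] at hk
  exact absurd hk not_top_lt

/-- A rate strictly above κ is chosen because κ may vanish. The factor ρ⁻² accounts for passing from
the exponent n - 1 to n + 1, the index n here standing for the crossing n + 1. -/
lemma exists_geometric_bound {κ : ℝ} (h0 : 0 ≤ κ) (h1 : κ < 1) :
    ∃ C ρ : ℝ, 0 < ρ ∧ ρ < 1 ∧ ∀ n : ℕ, κ ^ (n - 1) ≤ C * ρ ^ (n + 1) := by
  obtain ⟨ρ, hκρ, hρ1⟩ := exists_between h1
  have hρ := h0.trans_lt hκρ
  refine ⟨(ρ ^ 2)⁻¹, ρ, hρ, hρ1, fun n => ?_⟩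
  rw [inv_mul_eq_div, le_div_iff₀ (by positivity)]
  calc κ ^ (n - 1) * ρ ^ 2 ≤ ρ ^ (n - 1) * ρ ^ 2 := by gcongr
    _ = ρ ^ (n - 1 + 2) := (pow_add _ _ _).symm
    _ ≤ ρ ^ (n + 1) := pow_le_pow_of_le_one hρ.le hρ1.le (by omega)

lemma sum_Icc_crossing (φ : ℝ × ℝ × ℝ × ℝ × ℕ → ℝ) (s : ℝ) (y : ℕ → Set.Iic M) (n : ℕ) :
    ∑ j ∈ Finset.Icc 1 n, φ (crossing a b s (fun k => (y k : ℝ)) j) =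
      ∑ j ∈ Finset.range n, φ (crossingSeq a b s y j) := by
  rw [← Finset.Ico_add_one_right_eq_Icc, Finset.sum_Ico_eq_sum_range]
  refine Finset.sum_congr rfl fun j _ => ?_
  rw [add_comm 1 j]
  rfl

end Main

end LevelCrossing

open LevelCrossing

theorem theorem2p5 (M : ℝ) (hM : 0 < M)
    (P : Kernel (Set.Iic M) (Set.Iic M)) [IsMarkovKernel P]
    (hminor : LevelCrossing.Minorized P) (hmean : LevelCrossing.ZeroMean P)
    (a b : ℝ) (ha : a < 0) (hb : 0 < b) :
    ∃ υ : Measure (ℝ × ℝ × ℝ × ℝ × ℕ),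
      IsProbabilityMeasure υ ∧ υ (LevelCrossing.stateSpace M a b) = 1 ∧
      ∃ C ρ : ℝ, 0 < ρ ∧ ρ < 1 ∧
        ∀ (Ω : Type u) [MeasurableSpace Ω] (μ : Measure Ω) [IsProbabilityMeasure μ]
          (X : ℕ → Ω → Set.Iic M) (S₀ : Ω → ℝ),
          LevelCrossing.IsMarkovChain P X μ →
          Measurable S₀ →
          IndepFun S₀ (fun ω n => X n ω) μ →
          (∀ n, 1 ≤ n → Integrable (fun ω => (X n ω : ℝ) ^ 2) μ) →
          -- the crossing times are almost surely finite
          (∀ᵐ ω ∂μ, ∀ n, 1 ≤ n →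
            LevelCrossing.timeT a b
              (LevelCrossing.walk (S₀ ω) (fun k => (X k ω : ℝ))) n ≠ ⊤ ∧
            LevelCrossing.timeL a b
              (LevelCrossing.walk (S₀ ω) (fun k => (X k ω : ℝ))) n ≠ ⊤) ∧
          -- the law of the crossing data is well defined and converges geometrically fast
          (∀ n, 1 ≤ n →
            AEMeasurable (fun ω =>
              LevelCrossing.crossing a b (S₀ ω) (fun k => (X k ω : ℝ)) n) μ ∧
            LevelCrossing.tvDist
              (μ.map (fun ω => LevelCrossing.crossing a b (S₀ ω) (fun k => (X k ω : ℝ)) n)) υ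
                ≤ C * ρ ^ n) ∧
          -- the law of large numbers
          (∀ φ : ℝ × ℝ × ℝ × ℝ × ℕ → ℝ, Measurable φ → (∃ K : ℝ, ∀ u, |φ u| ≤ K) →
            ∀ᵐ ω ∂μ, Tendsto
              (fun n : ℕ => (∑ j ∈ Finset.Icc 1 n,
                φ (LevelCrossing.crossing a b (S₀ ω) (fun k => (X k ω : ℝ)) j)) / (n : ℝ))
              atTop (𝓝 (∫ u, φ u ∂υ))) := by
  obtain ⟨c, h, hc, hc', hh, hhM, hsteps⟩ := hminor.exists_smallSteps hM
  have hab : a ≤ b := (ha.trans hb).le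
  have hosc := fun x s => ae_oscillates hM hmean hc hc' hh hhM hsteps a b x s
  obtain ⟨ε, hε, hε', hminorize⟩ := hsteps.exists_minorization hc hh hhM hab (b + M)
  have hfin : IsFiniteMeasure (ε • landingLaw M b h) := Measure.smul_finite _ hε'
  have hE : MeasurableSet (Set.univ ×ˢ Set.Ioc b (b + M) : Set (Set.Iic M × ℝ)) :=
    MeasurableSet.univ.prod measurableSet_Ioc
  -- The set E' contains every upcrossing state, whatever the start, and the minorization holds on
  -- it because its positions are at most b + M.
  obtain ⟨π, hπ, hπE, hπH, ⟨κ, hκ0, hκ1, hκ⟩, hlln⟩ :=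
    (renews_crossingKernel hosc).exists_stationary (E' := Set.univ ×ˢ Set.Ioc b (b + M))
      (β := ε • landingLaw M b h)
      (fun w => by
        rw [renewalKernel_crossingKernel_apply w hE.compl, ← nonpos_iff_eq_zero]
        refine (measure_eq_zero_iff_ae_notMem.2 ?_).le
        filter_upwards [hosc w.1 w.2] with y hy
        exact not_not.2 (restart_mem_Ioc hab hy))
      (fun w hw => hminorize w (hab.trans hw.2.1.le) hw.2.2) hE
      ⟨(toIic M 0, b + M), trivial, by simp [hM]⟩
      (by
        intro h0
        have h1 := congrArg (fun m => m Set.univ) h0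
        simp only [Measure.smul_apply, smul_eq_mul, Measure.coe_zero, Pi.zero_apply, mul_eq_zero,
          hε, false_or, Measure.measure_univ_eq_zero] at h1
        exact landingLaw_ne_zero M b hh h1)
  -- The exceptional states are null for the minorizing measure and cannot be entered from outside,
  -- so the invariant law does not charge them.
  have hlevel : π (levelStates P b) = 0 :=
    hπH _ (measurableSet_levelStates P b)
      (by rw [Measure.smul_apply, landingLaw_levelStates, smul_zero])
      fun w hw => renewalKernel_levelStates hosc hw
  have hR : IsMarkovKernel ((crossingKernel P a b).map fun u => u 0) :=
    Kernel.IsMarkovKernel.map _ (measurable_pi_apply 0)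
  obtain ⟨C, ρ, hρ0, hρ1, hρ⟩ := exists_geometric_bound hκ0 hκ1
  refine ⟨π.bind ((crossingKernel P a b).map fun u => u 0), inferInstance,
    bind_crossingKernel_stateSpace hosc hab hπE hlevel, C, ρ, hρ0, hρ1, ?_⟩
  intro Ω _ μ _ X S₀ hX hS₀ hind _
  have hXm : Measurable fun ω n => X n ω := measurable_pi_iff.2 hX.1
  have hpair : Measurable fun ω => (S₀ ω, fun n => X n ω) := hS₀.prodMk hXm
  have hlaw := hX.map_prodMk hS₀ hind
  have hσ : IsProbabilityMeasure (μ.map S₀) :=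
    Measure.isProbabilityMeasure_map hS₀.aemeasurable
  have hν : IsProbabilityMeasure (μ.map (X 0)) :=
    Measure.isProbabilityMeasure_map (hX.1 0).aemeasurable
  -- The joint law of start and chain is a mixture of the path laws, so statements almost sure from
  -- every initial state hold almost surely on Ω.
  have hae : ∀ H : Set (ℝ × (ℕ → Set.Iic M)), MeasurableSet H →
      (∀ x s, ∀ᵐ y ∂(pathKernel P x), (s, y) ∈ H) →
      ∀ᵐ ω ∂μ, (S₀ ω, fun n => X n ω) ∈ H := fun H hH h =>
    ae_of_ae_map hpair.aemeasurable (hlaw ▸ ae_prod_bind_pathKernel _ _ hH h)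
  refine ⟨?_, fun n hn => ?_, fun φ hφ hK => ?_⟩
  · have h1 := hae (⋂ n, {p | timeL a b (walk p.1 fun k => (p.2 k : ℝ)) n ≠ ⊤})
      (MeasurableSet.iInter measurableSet_timeL_ne_top) (fun x s => by
        filter_upwards [hosc x s] with y hy
        exact Set.mem_iInter.2 fun n => hy.timeL_ne_top n)
    filter_upwards [h1] with ω hω n hn
    obtain ⟨n, rfl⟩ := Nat.exists_eq_add_of_le' hn
    have h2 := Set.mem_iInter.1 hω (n + 1)
    exact ⟨timeT_succ_ne_top h2, h2⟩
  · obtain ⟨n, rfl⟩ := Nat.exists_eq_add_of_le' hn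
    have hm : Measurable fun ω => crossing a b (S₀ ω) (fun k => (X k ω : ℝ)) (n + 1) :=
      measurable_crossing hS₀ (fun k => measurable_subtype_coe.comp (hX.1 k)) a b (n + 1)
    refine ⟨hm.aemeasurable, ?_⟩
    have : Nonempty {A : Set (ℝ × ℝ × ℝ × ℝ × ℕ) // MeasurableSet A} := ⟨⟨∅, MeasurableSet.empty⟩⟩
    refine ciSup_le fun A => ?_
    have hB : MeasurableSet {u : ℕ → ℝ × ℝ × ℝ × ℝ × ℕ | u n ∈ A.1} := measurable_pi_apply n A.2
    have h1 := abs_measureReal_crossingSeq_sub_le (μ.map S₀) (μ.map (X 0)) hB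
      (fun w => hκ A.1 A.2 n w)
    rw [← hlaw, map_measureReal_apply hpair (measurable_crossingSeq_uncurry a b hB)] at h1
    rw [map_measureReal_apply hm A.2]
    exact h1.trans (hρ n)
  · have hmean : ∀ n : ℕ, Measurable fun p : ℝ × (ℕ → Set.Iic M) =>
        (∑ j ∈ Finset.range n, φ (crossingSeq a b p.1 p.2 j)) / (n : ℝ) := fun n =>
      (Finset.measurable_sum _ fun j _ => hφ.comp
        ((measurable_pi_apply j).comp (measurable_crossingSeq_uncurry a b))).div_const _
    have h1 := hae _ (measurableSet_tendsto (l := atTop)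
      (𝓝 (∫ u, φ u ∂(π.bind ((crossingKernel P a b).map fun u => u 0)))) hmean) (fun x s => by
        have h2 := hlln φ hφ hK (x, s)
        rw [crossingKernel_apply] at h2
        exact ae_of_ae_map (measurable_crossingSeq a b s).aemeasurable h2)
    filter_upwards [h1] with ω hω
    simp_rw [sum_Icc_crossing φ (S₀ ω) (fun k => X k ω)]
    exact hω
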